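/- Let $U=\begin{bmatrix}a&b\\c&d\end{bmatrix}$ and $U_0=\begin{bmatrix}a_0&b_0\\c_0&d_0\end{bmatrix}$ be unitary $2\times2$ matrices with $\det U=\det U_0$, $a\neq0$, $c\neq0$ and $a_0\neq0$. Put $U_x=U$ for $x\in\mathbb{Z}\setminus\{0\}$ (and $U_x=U_0$ for $x=0$). Consider the two-state quantum walk on $\mathbb{Z}$ given by $$\Psi_{n+1}(x)=P_{x+1}\Psi_n(x+1)+Q_{x-1}\Psi_n(x-1)\qquad(x\in\mathbb{Z},\ n\ge0),$$ where $\Psi_n(x)={}^T[\Psi_n^{(L)}(x),\Psi_n^{(R)}(x)]\in\mathbb{C}^2$, and $P_x$ (resp. $Q_x$) is the matrix obtained from $U_x$ by replacing the second (resp. first) row by zero. The walk starts with $\Psi_0(0)={}^T[\alpha,\beta]$, $|\alpha|^2+|\beta|^2=1$, and $\Psi_0(x)=0$ for $x\ne0$. Let $\mu_n(x)=|\Psi_n^{(L)}(x)|^2+|\Psi_n^{(R)}(x)|^2$ and $m=\mathrm{Re}(\bar c c_0)$. Then for every $x\in\mathbb{Z}$ the limit $$\overline{\mu}_\infty(x)=\lim_{T\to\infty}\frac1T\sum_{n=0}^{T-1}\mu_n(x)$$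 exists, and it is given as follows. 1. At the origin, $$\overline{\mu}_\infty(0)=I_{\{|c|^2>m\}}\,\frac12\left(\frac{2(|c|^2-m)}{1-2m+|c|^2}\right)^2 ,$$ where $I_{\{|c|^2>m\}}$ is $1$ if $|c|^2>m$ and $0$ otherwise. 2. For $|x|\ge1$, $$\overline{\mu}_\infty(x)=\overline{\mu}_\infty(0)\,\frac{|c|^2(1-m)}{(|c|^2-m^2)(1-2m+|c|^2)}\left(\frac{|a|^2}{1-2m+|c|^2}\right)^{|x|-1}\kappa_{\mathrm{sgn}(x)},$$ where $$\kappa_{+}=\left(1+|c_0|^2-\frac{2m^2}{|c|^2}\right)|\alpha|^2+|a_0|^2|\beta|^2+2\,\mathrm{Re}\!\left(\alpha\bar\beta\,\bar d_0\,(c_0-m/\bar c)\right)\qquad(x\ge1),$$ $$\kappa_{-}=\left(1+|c_0|^2-\frac{2m^2}{|c|^2}\right)|\beta|^2+|a_0|^2|\alpha|^2-2\,\mathrm{Re}\!\left(\alpha\bar\beta\,\bar d_0\,(c_0-m/\bar c)\right)\qquad(x\le-1).$$ If $|c|^2>m$, then the ratio $|a|^2/(1-2m+|c|^2)$ lies strictly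 between $0$ and $1$. Say that the walk exhibits localization at $x$ if $\overline{\mu}_\infty(x)>0$. Then localization occurs at the origin if and only if $|c|^2>m$, and localization occurs at some position $x\in\mathbb{Z}$ if and only if $|c|^2>m$. -/

import Mathlib

open scoped ComplexConjugate Matrix

/-- The state space `(ℂ²)^ℤ` of a two-state walk on `ℤ`: coordinate `0` is the left chirality `L`,
coordinate `1` is the right chirality `R`. -/
abbrev WalkState := ℤ → Fin 2 → ℂ

/-- `P_x`: the upper row of the coin, the part of the coin that sends the walker to the left. -/
def leftPart (V : Matrix (Fin 2) (Fin 2) ℂ) : Matrix (Fin 2) (Fin 2) ℂ :=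
  !![V 0 0, V 0 1; 0, 0]

/-- `Q_x`: the lower row of the coin, the part of the coin that sends the walker to the right. -/
def rightPart (V : Matrix (Fin 2) (Fin 2) ℂ) : Matrix (Fin 2) (Fin 2) ℂ :=
  !![0, 0; V 1 0, V 1 1]

/-- One step of the quantum walk with coin `coin x` at the position `x`:
`(step Ψ)(x) = P_{x+1} Ψ(x+1) + Q_{x-1} Ψ(x-1)`. -/
def walkStep (coin : ℤ → Matrix (Fin 2) (Fin 2) ℂ) (Ψ : WalkState) : WalkState :=
  fun x => leftPart (coin (x + 1)) *ᵥ Ψ (x + 1) + rightPart (coin (x - 1)) *ᵥ Ψ (x - 1)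

/-- The state `Ψ_n` at time `n` of the walk with initial state `Ψ₀`. -/
def walkAt (coin : ℤ → Matrix (Fin 2) (Fin 2) ℂ) (Ψ₀ : WalkState) (n : ℕ) : WalkState :=
  (walkStep coin)^[n] Ψ₀

/-- `μ_n(x) = |Ψ_n^{(L)}(x)|² + |Ψ_n^{(R)}(x)|²`, the probability `P(X_n = x)` when the initial state
is a unit vector. -/
noncomputable def walkMeasure (coin : ℤ → Matrix (Fin 2) (Fin 2) ℂ) (Ψ₀ : WalkState)
    (n : ℕ) (x : ℤ) : ℝ :=
  ‖walkAt coin Ψ₀ n x 0‖ ^ 2 + ‖walkAt coin Ψ₀ n x 1‖ ^ 2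

/-- The time average `(1/T) ∑_{n=0}^{T-1} μ_n(x)`. -/
noncomputable def timeAverage (coin : ℤ → Matrix (Fin 2) (Fin 2) ℂ) (Ψ₀ : WalkState)
    (T : ℕ) (x : ℤ) : ℝ :=
  (1 / (T : ℝ)) * ∑ n ∈ Finset.range T, walkMeasure coin Ψ₀ n x

/-- `μ` is the time averaged limit measure of the walk with initial state `Ψ₀`: at every position
the time averages converge, and their limit is `μ`. -/
def IsTimeAveragedLimit (coin : ℤ → Matrix (Fin 2) (Fin 2) ℂ) (Ψ₀ : WalkState) (μ : ℤ → ℝ) : Prop :=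
  ∀ x : ℤ, Filter.Tendsto (fun T : ℕ => timeAverage coin Ψ₀ T x) Filter.atTop (nhds (μ x))

/-- The walk exhibits localization at the position `x`: the time averages at `x` converge to a
positive limit. -/
def LocalizesAt (coin : ℤ → Matrix (Fin 2) (Fin 2) ℂ) (Ψ₀ : WalkState) (x : ℤ) : Prop :=
  ∃ l : ℝ, 0 < l ∧
    Filter.Tendsto (fun T : ℕ => timeAverage coin Ψ₀ T x) Filter.atTop (nhds l)

/-- The coins of a walk with one defect: `U₀` at the origin, `U` at every other position. -/
def oneDefectCoin (U₀ U : Matrix (Fin 2) (Fin 2) ℂ) : ℤ → Matrix (Fin 2) (Fin 2) ℂ :=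
  fun x => if x = 0 then U₀ else U

/-- The initial state that sits at the origin with coin state `[α, β]`. -/
def originState (α β : ℂ) : WalkState :=
  fun x => if x = 0 then ![α, β] else 0

/-! The walk is an isometry U of ℓ²(ℤ; ℂ²), and μ_n(x) is a sum of two terms |⟨φ, Uⁿψ⟩|². By
Wiener's lemma the time average of such a term retains only the point spectrum: for simple
eigenvalues with eigenvectors f_i it tends to ∑ |⟨f_i, ψ⟩|² |⟨φ, f_i⟩|² / ‖f_i‖⁴. Everything reduces
to finding the square summable eigenvectors.

Wiener's lemma is proved without spectral measures. The averages of |Uⁿψ⟩⟨Uⁿψ| are ergodic averages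
of an isometry on Hilbert–Schmidt tensors, so they are Cauchy in operator norm
(`cauchySeq_orbitAverage`). The limit is compact, symmetric and commutes with U. Its eigenspaces of
nonzero eigenvalue are finite-dimensional and U-invariant, so they contain eigenvectors of U, and
the limit is determined by its action on these (`LinearIsometry.tendsto_average_norm_inner_sq`).

Away from the origin the coin is constant, and two conserved quantities force a decaying eigenvector
to be geometric on each half line (`exists_geometric_of_tendsto_zero`). Matching at the defect
leaves |c|²h² - 2mh + 1 = 0, which has two nonreal conjugate roots (`exists_root_of_boundState`).
Each root determines λ², and the squared decay ratio is always |a|²/(1 - 2m + |c|²)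
(`norm_sq_ratio_of_root`). Since |a|² + |c|² = 1, it is below 1 exactly when m < |c|². Thus there
are four bound states or none, and in the first case the sum over them is evaluated by
`weighted_sums`. -/

open scoped InnerProductSpace TensorProduct

/-! ### Mean ergodic theorem without completeness -/

/-- The mean ergodic theorem applies to the extension of `V` to the completion, and the embedding
into the completion is isometric, so the Cauchy property pulls back. This form is needed because the
algebraic tensor product is not complete in general. -/
theorem LinearIsometry.cauchySeq_birkhoffAverage {E : Type*} [NormedAddCommGroup E]
    [InnerProductSpace ℝ E] (V : E →ₗᵢ[ℝ] E) (x : E) :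
    CauchySeq fun n : ℕ => birkhoffAverage ℝ V _root_.id n x := by
  set W := V.toContinuousLinearMap.completion with hW
  have hWx : ∀ y : E, W (y : UniformSpace.Completion E) = (V y : E) := fun y => by
    simp [hW]
  have hnorm : ‖W‖ ≤ 1 := by
    refine W.opNorm_le_bound zero_le_one fun y => ?_
    induction y using UniformSpace.Completion.induction_on with
    | hp => exact isClosed_le (by fun_prop) (by fun_prop)
    | ih y => simp [hWx]
  have hit : ∀ (k : ℕ) (y : E), W^[k] (y : UniformSpace.Completion E) = (V^[k] y : E) := by
    intro k
    induction k with
    | zero => simp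
    | succ k ih => intro y; simp only [Function.iterate_succ_apply, hWx, ih]
  have hav : ∀ n : ℕ, birkhoffAverage ℝ W _root_.id n (x : UniformSpace.Completion E)
      = ((birkhoffAverage ℝ V _root_.id n x : E) : UniformSpace.Completion E) := by
    intro n
    simp only [birkhoffAverage, birkhoffSum, _root_.id, hit, UniformSpace.Completion.coe_smul]
    congr 1
    exact (map_sum (UniformSpace.Completion.toComplL (𝕜 := ℝ) (E := E)) _ _).symm
  have h := (W.tendsto_birkhoffAverage_orthogonalProjection hnorm x).cauchySeq
  simp only [hav] at h
  rw [Metric.cauchySeq_iff] at h ⊢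
  simpa using h

/-! ### Wiener's lemma through averages of rank one operators -/

section RankOneAverage

attribute [local instance] InnerProductSpace.complexToReal

variable {H : Type*} [NormedAddCommGroup H] [InnerProductSpace ℂ H]

/-- The orbit average `(1/T) ∑_{n<T} |Uⁿψ⟩⟨Uⁿψ|`. -/
noncomputable def orbitAverage (U : H →ₗᵢ[ℂ] H) (ψ : H) (T : ℕ) : H →L[ℂ] H :=
  ((T : ℝ)⁻¹) • ∑ n ∈ Finset.range T, InnerProductSpace.rankOne ℂ (U^[n] ψ) (U^[n] ψ)

/-- The operator norm is at most the Hilbert–Schmidt norm, with the tensor `ξ` standing for `A`. The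
bound comes from testing with `φ = A χ`. -/
theorem norm_le_of_re_inner_eq_inner_tmul (A : H →L[ℂ] H) (ξ : H ⊗[ℝ] H)
    (h : ∀ φ χ : H, (⟪φ, A χ⟫_ℂ).re = ⟪φ ⊗ₜ[ℝ] χ, ξ⟫_ℝ) : ‖A‖ ≤ ‖ξ‖ := by
  refine A.opNorm_le_bound (norm_nonneg _) fun χ => ?_
  have h1 : ‖A χ‖ ^ 2 ≤ ‖A χ‖ * ‖χ‖ * ‖ξ‖ := by
    have h2 := h (A χ) χ
    have h3 : (⟪A χ, A χ⟫_ℂ).re = ‖A χ‖ ^ 2 := by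
      rw [inner_self_eq_norm_sq_to_K]; norm_cast
    rw [← h3, h2]
    refine (real_inner_le_norm (A χ ⊗ₜ[ℝ] χ) ξ).trans ?_
    rw [TensorProduct.norm_tmul]
  rcases (norm_nonneg (A χ)).eq_or_lt with h0 | h0
  · rw [← h0]; positivity
  · nlinarith

/-- The real tensor that represents the rank one operator `|u⟩⟨u|`. -/
noncomputable def realTensor (u : H) : H ⊗[ℝ] H :=
  u ⊗ₜ[ℝ] u + (Complex.I • u) ⊗ₜ[ℝ] (Complex.I • u)

/-- With z = ⟨φ, u⟩ and w = ⟨χ, u⟩ this is Re(z w̄) = Re z Re w + Im z Im w. The second summand of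
`realTensor` supplies the imaginary parts, so real tensors can replace the product of H with its
conjugate space. -/
theorem re_inner_rankOne_eq (u φ χ : H) :
    (⟪φ, InnerProductSpace.rankOne ℂ u u χ⟫_ℂ).re = ⟪φ ⊗ₜ[ℝ] χ, realTensor u⟫_ℝ := by
  have hr : ∀ x y : H, ⟪x, y⟫_ℝ = (⟪x, y⟫_ℂ).re := fun x y => rfl
  have hs : ⟪u, χ⟫_ℂ = conj ⟪χ, u⟫_ℂ := (inner_conj_symm _ _).symm
  simp only [realTensor, inner_add_right, TensorProduct.inner_tmul, hr,
    InnerProductSpace.rankOne_apply, inner_smul_right, hs, Complex.mul_re, Complex.conj_re,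
    Complex.conj_im, Complex.I_re, Complex.I_im]
  ring

/-- The isometry U ⊗ U carries the tensor of u to that of U u. The orbit averages are therefore its
Birkhoff averages, and the Hilbert–Schmidt bound transfers the Cauchy property to the operator norm.
-/
theorem cauchySeq_orbitAverage (U : H →ₗᵢ[ℂ] H) (ψ : H) :
    CauchySeq (orbitAverage U ψ) := by
  let UR : H →ₗᵢ[ℝ] H := ⟨U.toLinearMap.restrictScalars ℝ, U.norm_map⟩
  have hUR : ∀ x, UR x = U x := fun _ => rfl
  let V := TensorProduct.mapIsometry UR UR
  have hV : ∀ u, V (realTensor u) = realTensor (U u) := by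
    intro u
    simp only [realTensor, map_add, V, TensorProduct.mapIsometry_apply, TensorProduct.map_tmul]
    simp [hUR]
  have hVn : ∀ n : ℕ, V^[n] (realTensor ψ) = realTensor (U^[n] ψ) := by
    intro n
    induction n with
    | zero => rfl
    | succ n ih => rw [Function.iterate_succ_apply', ih, hV, Function.iterate_succ_apply']
  have hrel : ∀ (T : ℕ) (φ χ : H), (⟪φ, orbitAverage U ψ T χ⟫_ℂ).re
      = ⟪φ ⊗ₜ[ℝ] χ, birkhoffAverage ℝ V id T (realTensor ψ)⟫_ℝ := by
    intro T φ χ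
    simp only [birkhoffAverage, birkhoffSum, id, hVn, orbitAverage, inner_smul_right, inner_sum,
      smul_apply, sum_apply, ← re_inner_rankOne_eq]
    rw [← Complex.coe_smul, inner_smul_right, inner_sum, Complex.re_ofReal_mul, Complex.re_sum]
  have hc := V.cauchySeq_birkhoffAverage (realTensor ψ)
  rw [Metric.cauchySeq_iff] at hc ⊢
  intro ε hε
  obtain ⟨N, hN⟩ := hc ε hε
  refine ⟨N, fun m hm n hn => lt_of_le_of_lt ?_ (hN m hm n hn)⟩
  rw [dist_eq_norm, dist_eq_norm]
  refine norm_le_of_re_inner_eq_inner_tmul _ _ fun φ χ => ?_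
  rw [sub_apply, inner_sub_right, inner_sub_right, Complex.sub_re, hrel, hrel]

theorem isCompactOperator_rankOne (u v : H) :
    IsCompactOperator (InnerProductSpace.rankOne ℂ u v) := by
  rw [InnerProductSpace.rankOne_def']
  have h : IsCompactOperator (innerSL ℂ v) := isCompactOperator_of_locallyCompactSpace_dom _
  exact h.clm_comp (ContinuousLinearMap.toSpanSingleton ℂ u)

theorem isCompactOperator_orbitAverage (U : H →ₗᵢ[ℂ] H) (ψ : H) (T : ℕ) :
    IsCompactOperator (orbitAverage U ψ T) := by
  have h : ∑ n ∈ Finset.range T, InnerProductSpace.rankOne ℂ (U^[n] ψ) (U^[n] ψ)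
      ∈ compactOperator (RingHom.id ℂ) H H :=
    Submodule.sum_mem _ fun n _ => isCompactOperator_rankOne _ _
  exact IsCompactOperator.smul h ((T : ℝ)⁻¹)

theorem orbitAverage_apply (U : H →ₗᵢ[ℂ] H) (ψ : H) (T : ℕ) (x : H) :
    orbitAverage U ψ T x = ((T : ℂ)⁻¹) • ∑ n ∈ Finset.range T, ⟪U^[n] ψ, x⟫_ℂ • U^[n] ψ := by
  simp only [orbitAverage, smul_apply, sum_apply, InnerProductSpace.rankOne_apply]
  rw [← Complex.coe_smul]
  push_cast
  rfl

theorem inner_orbitAverage_apply (U : H →ₗᵢ[ℂ] H) (ψ : H) (T : ℕ) (x y : H) :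
    ⟪x, orbitAverage U ψ T y⟫_ℂ
      = (T : ℂ)⁻¹ * ∑ n ∈ Finset.range T, ⟪x, U^[n] ψ⟫_ℂ * ⟪U^[n] ψ, y⟫_ℂ := by
  rw [orbitAverage_apply, inner_smul_right, inner_sum]
  simp only [inner_smul_right, mul_comm]

theorem inner_orbitAverage_self (U : H →ₗᵢ[ℂ] H) (ψ : H) (T : ℕ) (x : H) :
    ⟪x, orbitAverage U ψ T x⟫_ℂ
      = ((1 / (T : ℝ) * ∑ n ∈ Finset.range T, ‖⟪x, U^[n] ψ⟫_ℂ‖ ^ 2 : ℝ) : ℂ) := by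
  rw [inner_orbitAverage_apply]
  push_cast
  rw [one_div]
  congr 1
  refine Finset.sum_congr rfl fun n _ => ?_
  rw [← inner_conj_symm (U^[n] ψ) x, Complex.mul_conj, Complex.normSq_eq_norm_sq]
  push_cast
  rfl

theorem isSymmetric_orbitAverage (U : H →ₗᵢ[ℂ] H) (ψ : H) (T : ℕ) (x y : H) :
    ⟪orbitAverage U ψ T x, y⟫_ℂ = ⟪x, orbitAverage U ψ T y⟫_ℂ := by
  rw [← inner_conj_symm, inner_orbitAverage_apply, inner_orbitAverage_apply]
  simp only [map_mul, map_sum, map_inv₀, Complex.conj_natCast, inner_conj_symm]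
  congr 1
  exact Finset.sum_congr rfl fun n _ => mul_comm _ _

/-- `U A_T U* - A_T` is of order `1 / T`, stated without the adjoint. -/
theorem norm_orbitAverage_commutator_le (U : H →ₗᵢ[ℂ] H) (ψ : H) (T : ℕ) (x : H) :
    ‖orbitAverage U ψ T (U x) - U (orbitAverage U ψ T x)‖ ≤ (T : ℝ)⁻¹ * (2 * ‖ψ‖ ^ 2 * ‖x‖) := by
  have hn : ∀ n : ℕ, ‖U^[n] ψ‖ = ‖ψ‖ := by
    intro n
    induction n with
    | zero => rfl
    | succ n ih => rw [Function.iterate_succ_apply', U.norm_map, ih]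
  have hb : ∀ n : ℕ, ‖⟪U^[n] ψ, U x⟫_ℂ • U^[n] ψ‖ ≤ ‖ψ‖ ^ 2 * ‖x‖ := by
    intro n
    rw [norm_smul, hn]
    have := norm_inner_le_norm (𝕜 := ℂ) (U^[n] ψ) (U x)
    rw [hn, U.norm_map] at this
    nlinarith [norm_nonneg ψ]
  have hs : ∑ n ∈ Finset.range T, ⟪U^[n] ψ, U x⟫_ℂ • U^[n] ψ
      - U (∑ n ∈ Finset.range T, ⟪U^[n] ψ, x⟫_ℂ • U^[n] ψ)
      = ⟪U^[0] ψ, U x⟫_ℂ • U^[0] ψ - ⟪U^[T] ψ, U x⟫_ℂ • U^[T] ψ := by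
    rw [← Finset.sum_range_sub' (fun n => ⟪U^[n] ψ, U x⟫_ℂ • U^[n] ψ), Finset.sum_sub_distrib,
      map_sum]
    congr 1
    refine Finset.sum_congr rfl fun n _ => ?_
    rw [map_smul, Function.iterate_succ_apply', U.inner_map_map]
  rw [orbitAverage_apply, orbitAverage_apply, map_smul, ← smul_sub, hs, norm_smul, norm_inv,
    Complex.norm_natCast]
  refine mul_le_mul_of_nonneg_left ?_ (by positivity)
  refine (norm_sub_le _ _).trans ?_
  linarith [hb 0, hb T]

theorem LinearIsometry.inner_eq_zero_of_eigenvalue_ne (U : H →ₗᵢ[ℂ] H) {f g : H} {μ ν : ℂ}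
    (hf : U f = μ • f) (hg : U g = ν • g) (hμν : μ ≠ ν) (hμ : ‖μ‖ = 1) : ⟪f, g⟫_ℂ = 0 := by
  have h := U.inner_map_map f g
  rw [hf, hg, inner_smul_left, inner_smul_right] at h
  have h1 : μ * conj μ = 1 := by
    rw [Complex.mul_conj, Complex.normSq_eq_norm_sq, hμ]; simp
  by_contra h0
  apply hμν
  have h2 : conj μ * ν = 1 := by
    apply mul_right_cancel₀ h0
    linear_combination h
  linear_combination (-μ) * h2 + ν * h1

theorem LinearIsometry.norm_eigenvalue (U : H →ₗᵢ[ℂ] H) {f : H} {μ : ℂ}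
    (hf : U f = μ • f) (h0 : f ≠ 0) : ‖μ‖ = 1 := by
  have h := U.norm_map f
  rw [hf, norm_smul] at h
  exact mul_right_cancel₀ (norm_ne_zero_iff.2 h0) (by linarith)

variable [CompleteSpace H]

/-- Norm convergence makes the limit of finite rank operators compact. It commutes with U because
the commutators telescope to O(1/T). -/
theorem exists_limit_orbitAverage (U : H →ₗᵢ[ℂ] H) (ψ : H) :
    ∃ K : H →L[ℂ] H, Filter.Tendsto (orbitAverage U ψ) Filter.atTop (nhds K) ∧
      IsCompactOperator K ∧ (∀ x y, ⟪K x, y⟫_ℂ = ⟪x, K y⟫_ℂ) ∧ ∀ x, K (U x) = U (K x) := by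
  obtain ⟨K, hK⟩ := cauchySeq_tendsto_of_complete (cauchySeq_orbitAverage U ψ)
  have hp : ∀ x, Filter.Tendsto (fun T => orbitAverage U ψ T x) Filter.atTop (nhds (K x)) :=
    fun x => ((ContinuousLinearMap.apply ℂ H x).continuous.tendsto K).comp hK
  refine ⟨K, hK, isCompactOperator_of_tendsto hK
    (Filter.Eventually.of_forall fun T => isCompactOperator_orbitAverage U ψ T), ?_, ?_⟩
  · intro x y
    refine tendsto_nhds_unique ((hp x).inner tendsto_const_nhds) ?_
    simp only [isSymmetric_orbitAverage]
    exact tendsto_const_nhds.inner (hp y)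
  · intro x
    have h1 := (hp (U x)).sub ((U.continuous.tendsto _).comp (hp x))
    have h2 : Filter.Tendsto (fun T : ℕ => (T : ℝ)⁻¹ * (2 * ‖ψ‖ ^ 2 * ‖x‖)) Filter.atTop
        (nhds 0) := by
      simpa only [zero_mul] using
        (tendsto_inv_atTop_nhds_zero_nat (𝕜 := ℝ)).mul_const (2 * ‖ψ‖ ^ 2 * ‖x‖)
    exact sub_eq_zero.1 (tendsto_nhds_unique h1
      (squeeze_zero_norm (fun T => norm_orbitAverage_commutator_le U ψ T x) h2))

/-- A compact symmetric operator that commutes with an isometry and kills all of its eigenvectors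
vanishes. -/
theorem eq_zero_of_commute_of_eigenvector (U : H →ₗᵢ[ℂ] H) (K : H →L[ℂ] H)
    (hK : IsCompactOperator K) (hs : ∀ x y, ⟪K x, y⟫_ℂ = ⟪x, K y⟫_ℂ)
    (hc : ∀ x, K (U x) = U (K x)) (hz : ∀ (g : H) (μ : ℂ), U g = μ • g → K g = 0) : K = 0 := by
  have hs' : (K : H →ₗ[ℂ] H).IsSymmetric := hs
  refine (ContinuousLinearMap.eq_zero_of_forall_hasEigenvalue_eq_zero hK hs').1 fun ν hν => ?_
  by_contra hν0
  -- For ν ≠ 0 compactness makes the eigenspace finite-dimensional, and U preserves it. Hence U has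
  -- an eigenvector there, which K both kills and scales by ν.
  have hfin := ContinuousLinearMap.finite_dimensional_eigenspace hK ν hν0
  set E := Module.End.eigenspace (K : H →ₗ[ℂ] H) ν with hE
  have hmem : ∀ x, x ∈ E ↔ K x = ν • x := fun x => by
    rw [hE, Module.End.mem_eigenspace_iff]; rfl
  have hinv : ∀ x ∈ E, U.toLinearMap x ∈ E := by
    intro x hx
    rw [hmem] at hx ⊢
    change K (U x) = ν • U x
    rw [hc, hx, map_smul]
  have : Nontrivial E := Submodule.nontrivial_iff_ne_bot.2 hν
  obtain ⟨μ, hμ⟩ := Module.End.exists_eigenvalue (U.toLinearMap.restrict hinv)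
  obtain ⟨g, hg, hg0⟩ := hμ.exists_hasEigenvector
  rw [Module.End.mem_eigenspace_iff] at hg
  have hg' : U g = μ • (g : H) := congrArg Subtype.val hg
  have h1 := hz g μ hg'
  rw [(hmem g).1 g.2, smul_eq_zero] at h1
  exact h1.elim hν0 fun h => hg0 (Subtype.ext h)

/-- **Wiener's lemma** for an isometry whose eigenvectors are, up to scalars, the finitely many
vectors `f i`, which belong to distinct eigenvalues. -/
theorem LinearIsometry.tendsto_average_norm_inner_sq {ι : Type*} [Fintype ι] (U : H →ₗᵢ[ℂ] H)
    (f : ι → H) (lam : ι → ℂ) (hf0 : ∀ i, f i ≠ 0) (hf : ∀ i, U (f i) = lam i • f i)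
    (hlam : Function.Injective lam)
    (hspan : ∀ (g : H) (μ : ℂ), U g = μ • g → g ≠ 0 → ∃ i, μ = lam i ∧ ∃ z : ℂ, g = z • f i) (ψ φ : H) :
    Filter.Tendsto (fun T : ℕ => 1 / (T : ℝ) * ∑ n ∈ Finset.range T, ‖⟪φ, U^[n] ψ⟫_ℂ‖ ^ 2)
      Filter.atTop (nhds (∑ i, ‖⟪f i, ψ⟫_ℂ‖ ^ 2 * ‖⟪φ, f i⟫_ℂ‖ ^ 2 / ‖f i‖ ^ 4)) := by
  classical
  obtain ⟨K, hK, hKc, hKs, hKU⟩ := exists_limit_orbitAverage U ψ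
  have hl1 : ∀ i, ‖lam i‖ = 1 := fun i => U.norm_eigenvalue (hf i) (hf0 i)
  have hlim : ∀ x : H, Filter.Tendsto
      (fun T : ℕ => 1 / (T : ℝ) * ∑ n ∈ Finset.range T, ‖⟪x, U^[n] ψ⟫_ℂ‖ ^ 2)
      Filter.atTop (nhds (⟪x, K x⟫_ℂ).re) := by
    intro x
    have h1 : Filter.Tendsto (fun T => ⟪x, orbitAverage U ψ T x⟫_ℂ) Filter.atTop
        (nhds ⟪x, K x⟫_ℂ) := Filter.Tendsto.inner tendsto_const_nhds
      (((ContinuousLinearMap.apply ℂ H x).continuous.tendsto K).comp hK)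
    have h2 := (Complex.continuous_re.tendsto _).comp h1
    refine h2.congr fun T => ?_
    rw [Function.comp_apply, inner_orbitAverage_self, Complex.ofReal_re]
  have horth : ∀ i j, i ≠ j → ⟪f i, f j⟫_ℂ = 0 := fun i j hij =>
    U.inner_eq_zero_of_eigenvalue_ne (hf i) (hf j) (fun h => hij (hlam h)) (hl1 i)
  have hconst : ∀ i (n : ℕ), ‖⟪f i, U^[n] ψ⟫_ℂ‖ = ‖⟪f i, ψ⟫_ℂ‖ := by
    intro i n
    induction n with
    | zero => rfl
    | succ n ih =>
      have h := U.inner_map_map (f i) (U^[n] ψ)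
      rw [hf, inner_smul_left] at h
      rw [Function.iterate_succ_apply', ← ih, ← h, norm_mul, RCLike.norm_conj, hl1, one_mul]
  have hself : ∀ i, ⟪f i, f i⟫_ℂ = ((‖f i‖ ^ 2 : ℝ) : ℂ) := fun i => by
    rw [inner_self_eq_norm_sq_to_K]; norm_cast
  have hnz : ∀ i, ((‖f i‖ : ℝ) : ℂ) ≠ 0 := fun i => by
    exact_mod_cast norm_ne_zero_iff.2 (hf0 i)
  -- K f_i satisfies the eigenvalue equation for λ_i, so it is a multiple of f_i. The factor is read
  -- off from ⟨f_i, K f_i⟩, the limit of averages that are constant for T > 0.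
  have hKf : ∀ i, K (f i) = ((‖⟪f i, ψ⟫_ℂ‖ ^ 2 / ‖f i‖ ^ 2 : ℝ) : ℂ) • f i := by
    intro i
    have h1 : U (K (f i)) = lam i • K (f i) := by rw [← hKU, hf, map_smul]
    have h2 : ∃ z : ℂ, K (f i) = z • f i := by
      by_cases h0 : K (f i) = 0
      · exact ⟨0, by rw [h0, zero_smul]⟩
      · obtain ⟨j, hj, z, hz⟩ := hspan _ _ h1 h0
        rw [← hlam hj] at hz
        exact ⟨z, hz⟩
    obtain ⟨z, hz⟩ := h2
    have h3 : (⟪f i, K (f i)⟫_ℂ).re = ‖⟪f i, ψ⟫_ℂ‖ ^ 2 := by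
      refine tendsto_nhds_unique (hlim (f i)) (tendsto_const_nhds.congr' ?_)
      filter_upwards [Filter.eventually_gt_atTop 0] with T hT
      simp only [hconst, Finset.sum_const, Finset.card_range, nsmul_eq_mul]
      field_simp
    have h4 : (⟪f i, K (f i)⟫_ℂ).im = 0 := by
      have := inner_conj_symm (𝕜 := ℂ) (f i) (K (f i))
      rw [hKs] at this
      exact Complex.conj_eq_iff_im.1 this
    have h5 : ⟪f i, K (f i)⟫_ℂ = ((‖⟪f i, ψ⟫_ℂ‖ ^ 2 : ℝ) : ℂ) := by
      apply Complex.ext <;> simp only [h3, h4, Complex.ofReal_re, Complex.ofReal_im]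
    rw [hz, inner_smul_right, hself] at h5
    rw [hz]
    congr 1
    have := hnz i
    push_cast at h5 ⊢
    field_simp
    exact h5
  -- The expected limit. One factor ‖f_i‖² comes from the eigenvalue of K at f_i, the other from
  -- normalizing the projection onto f_i.
  set S : H →L[ℂ] H := ∑ i, ((‖⟪f i, ψ⟫_ℂ‖ ^ 2 / ‖f i‖ ^ 4 : ℝ) : ℂ) •
    InnerProductSpace.rankOne ℂ (f i) (f i) with hS
  have hSx : ∀ x, S x = ∑ i, ((‖⟪f i, ψ⟫_ℂ‖ ^ 2 / ‖f i‖ ^ 4 : ℝ) : ℂ) • ⟪f i, x⟫_ℂ • f i := by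
    intro x
    simp only [hS, smul_apply, sum_apply, InnerProductSpace.rankOne_apply]
  have hSf : ∀ i, S (f i) = K (f i) := by
    intro i
    rw [hSx, Finset.sum_eq_single i (fun j _ hj => by rw [horth j i hj]; simp) (by simp), hKf,
      smul_smul, hself]
    congr 1
    have := hnz i
    push_cast
    field_simp
  have hSc : IsCompactOperator S := by
    have : S ∈ compactOperator (RingHom.id ℂ) H H :=
      Submodule.sum_mem _ fun i _ => Submodule.smul_mem _ _ (isCompactOperator_rankOne _ _)
    exact this
  have hSs : ∀ x y, ⟪S x, y⟫_ℂ = ⟪x, S y⟫_ℂ := by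
    intro x y
    simp only [hSx, sum_inner, inner_sum, inner_smul_left, inner_smul_right, Complex.conj_ofReal,
      inner_conj_symm]
    exact Finset.sum_congr rfl fun i _ => by ring
  have hSU : ∀ x, S (U x) = U (S x) := by
    intro x
    simp only [hSx, map_sum, map_smul, hf]
    refine Finset.sum_congr rfl fun i _ => ?_
    have h := U.inner_map_map (f i) x
    rw [hf, inner_smul_left] at h
    have h1 : lam i * conj (lam i) = 1 := by
      rw [Complex.mul_conj, Complex.normSq_eq_norm_sq, hl1]; simp
    rw [← h, smul_smul (conj (lam i) * _) (lam i)]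
    congr 2
    linear_combination (-⟪f i, U x⟫_ℂ) * h1
  have hKS : K - S = 0 := by
    refine eq_zero_of_commute_of_eigenvector U (K - S) (hKc.sub hSc) ?_ ?_ ?_
    · intro x y
      simp only [sub_apply, inner_sub_left, inner_sub_right, hKs, hSs]
    · intro x
      simp only [sub_apply, map_sub, hKU, hSU]
    · intro g μ hg
      by_cases h0 : g = 0
      · rw [h0, map_zero]
      · obtain ⟨i, -, z, rfl⟩ := hspan g μ hg h0
        rw [map_smul, sub_apply, hSf, sub_self, smul_zero]
  have hval : (⟪φ, K φ⟫_ℂ).re = ∑ i, ‖⟪f i, ψ⟫_ℂ‖ ^ 2 * ‖⟪φ, f i⟫_ℂ‖ ^ 2 / ‖f i‖ ^ 4 := by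
    rw [sub_eq_zero.1 hKS, hSx, inner_sum, Complex.re_sum]
    refine Finset.sum_congr rfl fun i _ => ?_
    rw [inner_smul_right, inner_smul_right, ← inner_conj_symm (f i) φ, mul_comm (conj _),
      Complex.mul_conj, Complex.normSq_eq_norm_sq, ← Complex.ofReal_mul, Complex.ofReal_re]
    ring
  rw [← hval]
  exact hlim φ

end RankOneAverage

/-! ### The walk as an isometry of ℓ²(ℤ; ℂ²) -/

section WalkSpace

theorem walkStep_apply_zero (coin : ℤ → Matrix (Fin 2) (Fin 2) ℂ) (Ψ : WalkState) (x : ℤ) :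
    walkStep coin Ψ x 0 = coin (x + 1) 0 0 * Ψ (x + 1) 0 + coin (x + 1) 0 1 * Ψ (x + 1) 1 := by
  simp [walkStep, leftPart, rightPart, dotProduct, Fin.sum_univ_two]

theorem walkStep_apply_one (coin : ℤ → Matrix (Fin 2) (Fin 2) ℂ) (Ψ : WalkState) (x : ℤ) :
    walkStep coin Ψ x 1 = coin (x - 1) 1 0 * Ψ (x - 1) 0 + coin (x - 1) 1 1 * Ψ (x - 1) 1 := by
  simp [walkStep, leftPart, rightPart, dotProduct, Fin.sum_univ_two]

/-- The Hilbert space `ℓ²(ℤ; ℂ²)`. -/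
noncomputable abbrev WalkSpace : Type := lp (fun _ : ℤ => EuclideanSpace ℂ (Fin 2)) 2

/-- The probability density `‖Ψ(x)‖²` of a state. -/
noncomputable def walkDensity (Ψ : WalkState) (x : ℤ) : ℝ := ‖Ψ x 0‖ ^ 2 + ‖Ψ x 1‖ ^ 2

theorem norm_toLp_sq (v : Fin 2 → ℂ) :
    ‖(WithLp.toLp 2 v : EuclideanSpace ℂ (Fin 2))‖ ^ 2 = ‖v 0‖ ^ 2 + ‖v 1‖ ^ 2 := by
  rw [EuclideanSpace.norm_sq_eq, Fin.sum_univ_two]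

/-- A square summable state, as an element of `ℓ²(ℤ; ℂ²)`. -/
noncomputable def toWalkSpace (Ψ : WalkState) (h : Summable (walkDensity Ψ)) : WalkSpace :=
  ⟨fun x => WithLp.toLp 2 (Ψ x), memℓp_gen (by
    simpa only [ENNReal.toReal_ofNat, Real.rpow_ofNat, norm_toLp_sq] using! h)⟩

theorem toWalkSpace_apply (Ψ : WalkState) (h : Summable (walkDensity Ψ)) (x : ℤ) :
    toWalkSpace Ψ h x = WithLp.toLp 2 (Ψ x) := rfl

/-- The state underlying an element of `ℓ²(ℤ; ℂ²)`. -/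
def WalkSpace.state (f : WalkSpace) : WalkState := fun x => (f x).ofLp

theorem WalkSpace.hasSum_walkDensity (f : WalkSpace) :
    HasSum (walkDensity f.state) (‖f‖ ^ 2) := by
  have h := lp.hasSum_norm (p := 2) (by simp) f
  simp only [ENNReal.toReal_ofNat, Real.rpow_ofNat] at h
  convert h using 1
  exact funext fun x => (norm_toLp_sq _).symm

theorem WalkSpace.state_toWalkSpace (Ψ : WalkState) (h : Summable (walkDensity Ψ)) :
    (toWalkSpace Ψ h).state = Ψ := rfl

theorem WalkSpace.state_smul (z : ℂ) (f : WalkSpace) : (z • f).state = z • f.state := rfl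

theorem norm_toWalkSpace_sq (Ψ : WalkState) {s : ℝ} (h : HasSum (walkDensity Ψ) s) :
    ‖toWalkSpace Ψ h.summable‖ ^ 2 = s :=
  (toWalkSpace Ψ h.summable).hasSum_walkDensity.unique h

theorem WalkSpace.state_injective : Function.Injective WalkSpace.state := by
  intro f g h
  ext x i
  exact congrFun (congrFun h x) i

theorem walkDensity_eq_of_unitary {V : Matrix (Fin 2) (Fin 2) ℂ}
    (hV : V ∈ Matrix.unitaryGroup (Fin 2) ℂ) (v : Fin 2 → ℂ) :
    ‖(V *ᵥ v) 0‖ ^ 2 + ‖(V *ᵥ v) 1‖ ^ 2 = ‖v 0‖ ^ 2 + ‖v 1‖ ^ 2 := by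
  have key : ∀ w : Fin 2 → ℂ, ((‖w 0‖ ^ 2 + ‖w 1‖ ^ 2 : ℝ) : ℂ) = star w ⬝ᵥ w := by
    intro w
    simp only [dotProduct, Fin.sum_univ_two, Pi.star_apply, RCLike.star_def]
    rw [Complex.conj_mul', Complex.conj_mul']
    push_cast
    rfl
  have h : star (V *ᵥ v) ⬝ᵥ (V *ᵥ v) = star v ⬝ᵥ v := by
    rw [Matrix.star_mulVec, Matrix.dotProduct_mulVec, Matrix.vecMul_vecMul,
      ← Matrix.star_eq_conjTranspose, (Matrix.mem_unitaryGroup_iff').1 hV, Matrix.vecMul_one]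
  rw [← key, ← key] at h
  exact_mod_cast h

/-- The coins preserve the density at each site. The shift then only reindexes the sums of the two
chiralities, in opposite directions. -/
theorem hasSum_walkDensity_walkStep {coin : ℤ → Matrix (Fin 2) (Fin 2) ℂ}
    (hcoin : ∀ x, coin x ∈ Matrix.unitaryGroup (Fin 2) ℂ) {Ψ : WalkState} {s : ℝ}
    (h : HasSum (walkDensity Ψ) s) : HasSum (walkDensity (walkStep coin Ψ)) s := by
  set g : Fin 2 → ℤ → ℝ := fun i x => ‖(coin x *ᵥ Ψ x) i‖ ^ 2 with hg
  have hsum : ∀ x, g 0 x + g 1 x = walkDensity Ψ x := fun x =>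
    walkDensity_eq_of_unitary (hcoin x) (Ψ x)
  have hg0 : ∀ i x, 0 ≤ g i x := fun i x => sq_nonneg _
  have h0 : Summable (g 0) := Summable.of_nonneg_of_le (hg0 0)
    (fun x => by linarith [hsum x, hg0 1 x]) h.summable
  have h1 : Summable (g 1) := Summable.of_nonneg_of_le (hg0 1)
    (fun x => by linarith [hsum x, hg0 0 x]) h.summable
  have hs : (∑' x, g 0 x) + ∑' x, g 1 x = s := by
    rw [← h0.tsum_add h1]
    simp only [hsum]
    exact h.tsum_eq
  have e0 := (Equiv.addRight (1 : ℤ)).hasSum_iff.2 h0.hasSum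
  have e1 := (Equiv.subRight (1 : ℤ)).hasSum_iff.2 h1.hasSum
  rw [← hs]
  convert e0.add e1 using 1
  funext x
  simp only [walkDensity, walkStep_apply_zero, walkStep_apply_one, hg, Function.comp_apply,
    Equiv.coe_addRight, Equiv.subRight_apply, Matrix.mulVec, dotProduct, Fin.sum_univ_two]

/-- The time evolution of the walk on `ℓ²(ℤ; ℂ²)`. -/
noncomputable def walkIsometry (coin : ℤ → Matrix (Fin 2) (Fin 2) ℂ)
    (hcoin : ∀ x, coin x ∈ Matrix.unitaryGroup (Fin 2) ℂ) : WalkSpace →ₗᵢ[ℂ] WalkSpace where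
  toFun f := toWalkSpace (walkStep coin f.state)
    (hasSum_walkDensity_walkStep hcoin f.hasSum_walkDensity).summable
  map_add' f g := by
    apply WalkSpace.state_injective
    funext x
    have h' : ∀ (u v : WalkSpace) y i, (u + v).state y i = u.state y i + v.state y i :=
      fun _ _ _ _ => rfl
    ext i
    fin_cases i <;>
    simp only [Fin.zero_eta, Fin.mk_one, h', WalkSpace.state_toWalkSpace, walkStep_apply_zero,
      walkStep_apply_one] <;> ring
  map_smul' z f := by
    apply WalkSpace.state_injective
    funext x
    have h' : ∀ (u : WalkSpace) y i, (z • u).state y i = z * u.state y i :=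
      fun _ _ _ => rfl
    ext i
    fin_cases i <;>
    simp only [Fin.zero_eta, Fin.mk_one, h', WalkSpace.state_toWalkSpace, walkStep_apply_zero,
      walkStep_apply_one, RingHom.id_apply] <;> ring
  norm_map' f := by
    have h := norm_toWalkSpace_sq _ (hasSum_walkDensity_walkStep hcoin f.hasSum_walkDensity)
    exact (sq_eq_sq₀ (norm_nonneg _) (norm_nonneg _)).1 h

theorem state_walkIsometry (coin : ℤ → Matrix (Fin 2) (Fin 2) ℂ)
    (hcoin : ∀ x, coin x ∈ Matrix.unitaryGroup (Fin 2) ℂ) (f : WalkSpace) :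
    (walkIsometry coin hcoin f).state = walkStep coin f.state := rfl

theorem state_iterate_walkIsometry (coin : ℤ → Matrix (Fin 2) (Fin 2) ℂ)
    (hcoin : ∀ x, coin x ∈ Matrix.unitaryGroup (Fin 2) ℂ) (f : WalkSpace) (n : ℕ) :
    ((walkIsometry coin hcoin)^[n] f).state = walkAt coin f.state n := by
  induction n with
  | zero => rfl
  | succ n ih =>
    rw [Function.iterate_succ_apply', state_walkIsometry, ih, walkAt, walkAt,
      Function.iterate_succ_apply']

/-- The basis vector of `ℓ²(ℤ; ℂ²)` at the position `x` and the chirality `i`. -/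
noncomputable def walkBasis (x : ℤ) (i : Fin 2) : WalkSpace :=
  lp.single 2 x (EuclideanSpace.single i (1 : ℂ))

theorem inner_walkBasis (x : ℤ) (i : Fin 2) (f : WalkSpace) :
    ⟪walkBasis x i, f⟫_ℂ = f.state x i := by
  rw [walkBasis, lp.inner_single_left, EuclideanSpace.inner_single_left]
  simp [WalkSpace.state]

theorem timeAverage_eq (coin : ℤ → Matrix (Fin 2) (Fin 2) ℂ)
    (hcoin : ∀ x, coin x ∈ Matrix.unitaryGroup (Fin 2) ℂ) (f : WalkSpace) (T : ℕ) (x : ℤ) :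
    timeAverage coin f.state T x =
      1 / (T : ℝ) * (∑ n ∈ Finset.range T,
        ‖⟪walkBasis x 0, (walkIsometry coin hcoin)^[n] f⟫_ℂ‖ ^ 2) +
      1 / (T : ℝ) * (∑ n ∈ Finset.range T,
        ‖⟪walkBasis x 1, (walkIsometry coin hcoin)^[n] f⟫_ℂ‖ ^ 2) := by
  simp only [timeAverage, walkMeasure, inner_walkBasis, state_iterate_walkIsometry,
    Finset.sum_add_distrib, mul_add]

theorem hasSum_walkDensity_originState (α β : ℂ) :
    HasSum (walkDensity (originState α β)) (‖α‖ ^ 2 + ‖β‖ ^ 2) := by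
  have h := hasSum_single (f := walkDensity (originState α β)) 0
    (fun x hx => by simp [walkDensity, originState, hx])
  simpa [walkDensity, originState] using h

theorem inner_toWalkSpace_originState (f : WalkSpace) (α β : ℂ) :
    ⟪f, toWalkSpace (originState α β) (hasSum_walkDensity_originState α β).summable⟫_ℂ
      = conj (f.state 0 0) * α + conj (f.state 0 1) * β := by
  rw [lp.inner_eq_tsum, tsum_eq_single 0 (fun x hx => by
    simp [toWalkSpace_apply, originState, hx])]
  simp [toWalkSpace_apply, originState, WalkSpace.state, PiLp.inner_apply]
  ring

/-- The time averaged limit measure in terms of the eigenvectors of the walk. -/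
theorem tendsto_timeAverage {ι : Type*} [Fintype ι] {coin : ℤ → Matrix (Fin 2) (Fin 2) ℂ}
    (hcoin : ∀ x, coin x ∈ Matrix.unitaryGroup (Fin 2) ℂ) (F : ι → WalkState) (lam : ι → ℂ)
    (N : ι → ℝ) (hN : ∀ i, HasSum (walkDensity (F i)) (N i)) (hN0 : ∀ i, N i ≠ 0)
    (hF : ∀ i, walkStep coin (F i) = lam i • F i) (hlam : Function.Injective lam)
    (hspan : ∀ (G : WalkState) (μ : ℂ), Summable (walkDensity G) → walkStep coin G = μ • G →
      G ≠ 0 → ∃ i, μ = lam i ∧ ∃ z : ℂ, G = z • F i) (α β : ℂ) (x : ℤ) :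
    Filter.Tendsto (fun T : ℕ => timeAverage coin (originState α β) T x) Filter.atTop
      (nhds (∑ i, ‖conj (F i 0 0) * α + conj (F i 0 1) * β‖ ^ 2 * walkDensity (F i) x
        / (N i) ^ 2)) := by
  set f : ι → WalkSpace := fun i => toWalkSpace (F i) (hN i).summable with hf
  have hfN : ∀ i, ‖f i‖ ^ 4 = (N i) ^ 2 := fun i => by
    rw [← norm_toWalkSpace_sq _ (hN i)]; ring
  have hspan' : ∀ (g : WalkSpace) (μ : ℂ), walkIsometry coin hcoin g = μ • g → g ≠ 0 →
      ∃ i, μ = lam i ∧ ∃ z : ℂ, g = z • f i := by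
    intro g μ hg hg0
    have hg' : walkStep coin g.state = μ • g.state := by
      rw [← state_walkIsometry coin hcoin, hg, WalkSpace.state_smul]
    have hg0' : g.state ≠ 0 := fun h => hg0 (WalkSpace.state_injective h)
    obtain ⟨i, hi, z, hz⟩ := hspan g.state μ g.hasSum_walkDensity.summable hg' hg0'
    refine ⟨i, hi, z, WalkSpace.state_injective ?_⟩
    rw [hz, WalkSpace.state_smul, hf, WalkSpace.state_toWalkSpace]
  have hf0 : ∀ i, f i ≠ 0 := by
    intro i h0
    apply hN0 i
    have h1 : ‖f i‖ ^ 2 = N i := norm_toWalkSpace_sq _ (hN i)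
    rw [← h1, h0, norm_zero, zero_pow two_ne_zero]
  have hfe : ∀ i, walkIsometry coin hcoin (f i) = lam i • f i := by
    intro i
    apply WalkSpace.state_injective
    rw [state_walkIsometry, WalkSpace.state_smul, hf, WalkSpace.state_toWalkSpace]
    exact hF i
  obtain ⟨ψ, hψ, hin⟩ : ∃ ψ : WalkSpace, ψ.state = originState α β ∧
      ∀ g : WalkSpace, ⟪g, ψ⟫_ℂ = conj (g.state 0 0) * α + conj (g.state 0 1) * β :=
    ⟨_, WalkSpace.state_toWalkSpace _ (hasSum_walkDensity_originState α β).summable,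
      fun g => inner_toWalkSpace_originState g α β⟩
  have h := (walkIsometry coin hcoin).tendsto_average_norm_inner_sq f lam hf0 hfe hlam hspan' ψ
  have h2 := (h (walkBasis x 0)).add (h (walkBasis x 1))
  rw [← hψ]
  simp only [timeAverage_eq coin hcoin ψ]
  convert h2 using 2
  rw [← Finset.sum_add_distrib]
  refine Finset.sum_congr rfl fun i _ => ?_
  rw [hin, inner_walkBasis, inner_walkBasis, hfN]
  simp only [hf, WalkSpace.state_toWalkSpace, walkDensity]
  ring

end WalkSpace

/-! ### Square summable eigenvectors are geometric on the half lines -/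

section Eigenvectors

/-- The relations between the entries of a unitary matrix of determinant `δ`. -/
structure UnitaryEntries (a b c d δ : ℂ) : Prop where
  d_eq : d = δ * conj a
  b_eq : b = -(δ * conj c)
  det_mul_conj : δ * conj δ = 1
  mul_conj_add : a * conj a + c * conj c = 1

theorem UnitaryEntries.of_mem {a b c d : ℂ} (h : !![a, b; c, d] ∈ Matrix.unitaryGroup (Fin 2) ℂ) :
    UnitaryEntries a b c d (!![a, b; c, d]).det := by
  have h1 := (Matrix.mem_unitaryGroup_iff').1 h
  have e := fun i j => congrFun (congrFun h1 i) j
  have e00 := e 0 0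
  have e01 := e 0 1
  have e10 := e 1 0
  have e11 := e 1 1
  simp [Matrix.mul_apply, Fin.sum_univ_two, Matrix.star_apply] at e00 e01 e10 e11
  rw [Matrix.det_fin_two_of]
  refine ⟨?_, ?_, ?_, ?_⟩
  · linear_combination (-d) * e00 + c * e01
  · linear_combination (-b) * e00 + a * e01
  · simp only [map_sub, map_mul]
    linear_combination (conj d * d + conj b * b) * e00 + e11 - (conj b * a + conj d * c) * e01
  · linear_combination e00

theorem norm_sq_add_norm_sq_of_unitary {a b c d : ℂ}
    (h : !![a, b; c, d] ∈ Matrix.unitaryGroup (Fin 2) ℂ) (u v : ℂ) :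
    ‖a * u + b * v‖ ^ 2 + ‖c * u + d * v‖ ^ 2 = ‖u‖ ^ 2 + ‖v‖ ^ 2 := by
  simpa [Matrix.mulVec, dotProduct, Fin.sum_univ_two] using walkDensity_eq_of_unitary h ![u, v]

namespace UnitaryEntries

variable {a b c d δ : ℂ}

theorem norm_det (h : UnitaryEntries a b c d δ) : ‖δ‖ = 1 := by
  have := h.det_mul_conj
  rw [Complex.mul_conj, Complex.normSq_eq_norm_sq] at this
  have h2 : ‖δ‖ ^ 2 = 1 := by exact_mod_cast this
  nlinarith [norm_nonneg δ]

theorem norm_d (h : UnitaryEntries a b c d δ) : ‖d‖ = ‖a‖ := by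
  rw [h.d_eq, norm_mul, h.norm_det, one_mul, RCLike.norm_conj]

theorem norm_b (h : UnitaryEntries a b c d δ) : ‖b‖ = ‖c‖ := by
  rw [h.b_eq, norm_neg, norm_mul, h.norm_det, one_mul, RCLike.norm_conj]

theorem norm_sq_add (h : UnitaryEntries a b c d δ) : ‖a‖ ^ 2 + ‖c‖ ^ 2 = 1 := by
  have := h.mul_conj_add
  rw [Complex.mul_conj', Complex.mul_conj'] at this
  exact_mod_cast this

theorem det_eq (h : UnitaryEntries a b c d δ) : a * d - b * c = δ := by
  rw [h.d_eq, h.b_eq]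
  linear_combination δ * h.mul_conj_add

end UnitaryEntries

/-- A decaying solution of the eigenvalue equation on a half line is geometric. -/
theorem exists_geometric_of_tendsto_zero {a b c d lam : ℂ} (ha : a ≠ 0) (hda : ‖d‖ = ‖a‖)
    (hiso : ∀ u v : ℂ, ‖a * u + b * v‖ ^ 2 + ‖c * u + d * v‖ ^ 2 = ‖u‖ ^ 2 + ‖v‖ ^ 2)
    (hlam : ‖lam‖ = 1) {X Y : ℕ → ℂ}
    (hX : ∀ n, lam * X n = a * X (n + 1) + b * Y n)
    (hY : ∀ n, lam * Y (n + 1) = c * X (n + 1) + d * Y n)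
    (hX0 : Filter.Tendsto X Filter.atTop (nhds 0)) (hY0 : Filter.Tendsto Y Filter.atTop (nhds 0)) :
    ‖X 0‖ = ‖Y 0‖ ∧ ∃ r : ℂ, ‖r‖ < 1 ∧ ∀ n, X n = X 0 * r ^ n ∧ Y n = Y 0 * r ^ n := by
  have hl0 : lam ≠ 0 := by
    rintro rfl
    simp at hlam
  -- The coin maps (X (n+1), Y n) to λ (X n, Y (n+1)), so unitarity and |λ| = 1 conserve the flux
  -- ‖X‖² - ‖Y‖². Decay makes it zero.
  have hflux : ∀ n, ‖X n‖ ^ 2 - ‖Y n‖ ^ 2 = ‖X 0‖ ^ 2 - ‖Y 0‖ ^ 2 := by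
    intro n
    induction n with
    | zero => rfl
    | succ n ih =>
      have h := hiso (X (n + 1)) (Y n)
      rw [← hX, ← hY, norm_mul, norm_mul, hlam, one_mul, one_mul] at h
      linarith
  have h1 : ‖X 0‖ = ‖Y 0‖ := by
    have ht := (hX0.norm.pow 2).sub (hY0.norm.pow 2)
    simp only [hflux] at ht
    have := tendsto_nhds_unique tendsto_const_nhds ht
    simp only [norm_zero] at this
    exact (sq_eq_sq₀ (norm_nonneg _) (norm_nonneg _)).1 (by linarith)
  refine ⟨h1, ?_⟩
  -- The Wronskian of the solution and its shift is multiplied by d/a, of modulus 1, at each step.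
  -- Decay makes it vanish, so the first two vectors (X, Y) are linearly dependent.
  have hdet : ∀ n, ‖X n * Y (n + 1) - Y n * X (n + 1)‖ = ‖X 0 * Y 1 - Y 0 * X 1‖ := by
    intro n
    induction n with
    | zero => rfl
    | succ n ih =>
      rw [← ih]
      have e : (lam * a) * (X (n + 1) * Y (n + 2) - Y (n + 1) * X (n + 2))
          = (lam * d) * (X n * Y (n + 1) - Y n * X (n + 1)) := by
        have e1 := hX n
        have e2 := hX (n + 1)
        have e3 := hY n
        have e4 := hY (n + 1)
        linear_combination (a * X (n + 1)) * e4 + (lam * Y (n + 1) - c * X (n + 1)) * e2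
          - (d * Y (n + 1)) * e1 + (b * Y (n + 1) - lam * X (n + 1)) * e3
      have e' := congrArg norm e
      simp only [norm_mul, hlam, hda, one_mul] at e'
      exact mul_left_cancel₀ (norm_ne_zero_iff.2 ha) e'
  have hdet0 : X 0 * Y 1 = Y 0 * X 1 := by
    have hX1 := hX0.comp (Filter.tendsto_add_atTop_nat 1)
    have hY1 := hY0.comp (Filter.tendsto_add_atTop_nat 1)
    have ht := ((hX0.mul hY1).sub (hY0.mul hX1)).norm
    simp only [Function.comp_apply, hdet] at ht
    have := tendsto_nhds_unique tendsto_const_nhds ht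
    simp only [mul_zero, sub_zero, norm_zero, norm_eq_zero] at this
    exact sub_eq_zero.1 this
  have hstepX : ∀ n, X (n + 1) = (lam * X n - b * Y n) / a := fun n => by
    rw [eq_div_iff ha]; linear_combination -(hX n)
  have hstepY : ∀ n, Y (n + 1) = (c * X (n + 1) + d * Y n) / lam := fun n => by
    rw [eq_div_iff hl0]; linear_combination hY n
  by_cases hz : X 0 = 0
  · have hz' : Y 0 = 0 := by
      rw [hz, norm_zero] at h1
      exact norm_eq_zero.1 h1.symm
    refine ⟨0, by simp, fun n => ?_⟩
    rw [hz, hz', zero_mul]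
    induction n with
    | zero => exact ⟨hz, hz'⟩
    | succ n ih =>
      have : X (n + 1) = 0 := by rw [hstepX, ih.1, ih.2]; simp
      exact ⟨this, by rw [hstepY, this, ih.2]; simp⟩
  · have hz' : Y 0 ≠ 0 := by
      rw [← norm_ne_zero_iff, ← h1]
      exact norm_ne_zero_iff.2 hz
    have hgeo : ∀ n, X n = X 0 * (X 1 / X 0) ^ n ∧ Y n = Y 0 * (X 1 / X 0) ^ n := by
      intro n
      have hx1 : X 1 = X 0 * (X 1 / X 0) := by field_simp
      have hy1 : Y 1 = Y 0 * (X 1 / X 0) := by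
        field_simp
        linear_combination hdet0
      set r := X 1 / X 0 with hr
      induction n with
      | zero => simp
      | succ n ih =>
        have e1 : X (n + 1) = X 0 * r ^ (n + 1) := by
          have := hstepX 0
          rw [zero_add, hx1] at this
          rw [hstepX, ih.1, ih.2, pow_succ']
          linear_combination (-(r ^ n)) * this
        refine ⟨e1, ?_⟩
        have := hstepY 0
        rw [zero_add, hx1, hy1] at this
        rw [hstepY, e1, ih.2]
        linear_combination (-(r ^ n)) * this
    refine ⟨X 1 / X 0, ?_, hgeo⟩
    rw [← tendsto_pow_atTop_nhds_zero_iff_norm_lt_one]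
    have ht := hX0.const_mul (X 0)⁻¹
    rw [mul_zero] at ht
    refine ht.congr fun n => ?_
    rw [(hgeo n).1, inv_mul_cancel_left₀ hz]

/-- The state that is geometric on both half lines. -/
def boundState (p q C C' r r' : ℂ) : WalkState
  | .ofNat 0 => ![p, q]
  | .ofNat (n + 1) => ![p * r ^ (n + 1), C * r ^ n]
  | .negSucc n => ![C' * r' ^ n, q * r' ^ (n + 1)]

section boundState

variable (p q C C' r r' : ℂ) (n : ℕ)

theorem boundState_natCast_zero : boundState p q C C' r r' (n : ℤ) 0 = p * r ^ n := by
  cases n <;> simp [boundState]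

theorem boundState_add_one_one : boundState p q C C' r r' ((n : ℤ) + 1) 1 = C * r ^ n := rfl

theorem boundState_neg_one : boundState p q C C' r r' (-(n : ℤ)) 1 = q * r' ^ n := by
  cases n with
  | zero => simp [boundState]
  | succ n =>
    have h : -((n + 1 : ℕ) : ℤ) = Int.negSucc n := rfl
    rw [h]
    rfl

theorem boundState_neg_add_one_zero :
    boundState p q C C' r r' (-((n : ℤ) + 1)) 0 = C' * r' ^ n := by
  have : -((n : ℤ) + 1) = Int.negSucc n := by rw [Int.negSucc_eq]
  rw [this]
  rfl

theorem smul_boundState (z : ℂ) :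
    z • boundState p q C C' r r' = boundState (z * p) (z * q) (z * C) (z * C') r r' := by
  funext x
  match x with
  | .ofNat 0 => ext i; fin_cases i <;> simp [boundState]
  | .ofNat (n + 1) =>
    ext i
    fin_cases i
    · exact (mul_assoc z p (r ^ (n + 1))).symm
    · exact (mul_assoc z C (r ^ n)).symm
  | .negSucc n =>
    ext i
    fin_cases i
    · exact (mul_assoc z C' (r' ^ n)).symm
    · exact (mul_assoc z q (r' ^ (n + 1))).symm

end boundState

/-- These are the four rays on each of which a `boundState` is a single geometric sequence. -/
theorem walkState_ext {F G : WalkState} (h1 : ∀ n : ℕ, F n 0 = G n 0)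
    (h2 : ∀ n : ℕ, F ((n : ℤ) + 1) 1 = G ((n : ℤ) + 1) 1)
    (h3 : ∀ n : ℕ, F (-(n : ℤ)) 1 = G (-(n : ℤ)) 1)
    (h4 : ∀ n : ℕ, F (-((n : ℤ) + 1)) 0 = G (-((n : ℤ) + 1)) 0) : F = G := by
  have hneg : ∀ n : ℕ, -((n : ℤ) + 1) = Int.negSucc n := fun n => by rw [Int.negSucc_eq]
  funext x
  ext i
  match x, i with
  | .ofNat n, 0 => exact h1 n
  | .negSucc n, 0 => rw [← hneg]; exact h4 n
  | .ofNat 0, 1 => exact h3 0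
  | .ofNat (n + 1), 1 => exact h2 n
  | .negSucc n, 1 => exact h3 (n + 1)

theorem walkDensity_boundState_pos {p q C C' r r' : ℂ} {S : ℝ} (hC : ‖C‖ = ‖p‖)
    (hr : ‖r‖ ^ 2 = S) (n : ℕ) :
    walkDensity (boundState p q C C' r r') ((n : ℤ) + 1) = ‖p‖ ^ 2 * (1 + S) * S ^ n := by
  have e : ((n : ℤ) + 1) = ((n + 1 : ℕ) : ℤ) := by push_cast; rfl
  rw [walkDensity, boundState_add_one_one, e, boundState_natCast_zero, norm_mul, norm_mul, hC,
    norm_pow, norm_pow, mul_pow, mul_pow, ← pow_mul, ← pow_mul, mul_comm (n + 1), mul_comm n,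
    pow_mul, pow_mul, hr]
  ring

theorem walkDensity_boundState_neg {p q C C' r r' : ℂ} {S : ℝ} (hC' : ‖C'‖ = ‖q‖)
    (hr' : ‖r'‖ ^ 2 = S) (n : ℕ) :
    walkDensity (boundState p q C C' r r') (-((n : ℤ) + 1)) = ‖q‖ ^ 2 * (1 + S) * S ^ n := by
  have e : ((n : ℤ) + 1) = ((n + 1 : ℕ) : ℤ) := by push_cast; rfl
  rw [walkDensity, boundState_neg_add_one_zero, e, boundState_neg_one, norm_mul, norm_mul, hC',
    norm_pow, norm_pow, mul_pow, mul_pow, ← pow_mul, ← pow_mul, mul_comm (n + 1), mul_comm n,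
    pow_mul, pow_mul, hr']
  ring

theorem hasSum_walkDensity_boundState {p q C C' r r' : ℂ} {S : ℝ} (hC : ‖C‖ = ‖p‖)
    (hC' : ‖C'‖ = ‖q‖) (hr : ‖r‖ ^ 2 = S) (hr' : ‖r'‖ ^ 2 = S) (hS : S < 1) :
    HasSum (walkDensity (boundState p q C C' r r')) (2 * (‖p‖ ^ 2 + ‖q‖ ^ 2) / (1 - S)) := by
  have hg := hasSum_geometric_of_lt_one (hr ▸ sq_nonneg _) hS
  have h0 : walkDensity (boundState p q C C' r r') ((0 : ℕ) : ℤ) = ‖p‖ ^ 2 + ‖q‖ ^ 2 := rfl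
  have h1 : HasSum (fun n : ℕ => walkDensity (boundState p q C C' r r') (n : ℤ))
      (‖p‖ ^ 2 * (1 + S) * (1 - S)⁻¹ + (‖p‖ ^ 2 + ‖q‖ ^ 2)) := by
    rw [← hasSum_nat_add_iff' 1, Finset.sum_range_one, h0, add_sub_cancel_right]
    simpa only [Nat.cast_add, Nat.cast_one, walkDensity_boundState_pos hC hr]
      using hg.mul_left (‖p‖ ^ 2 * (1 + S))
  have h2 := hg.mul_left (‖q‖ ^ 2 * (1 + S))
  simp only [← walkDensity_boundState_neg (p := p) (C := C) (r := r) hC' hr'] at h2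
  convert HasSum.of_nat_of_neg_add_one h1 h2 using 1
  have : 1 - S ≠ 0 := by linarith
  field_simp
  ring

variable {a b c d a₀ b₀ c₀ d₀ : ℂ}

theorem oneDefectCoin_of_ne {U₀ U : Matrix (Fin 2) (Fin 2) ℂ} {x : ℤ} (hx : x ≠ 0) :
    oneDefectCoin U₀ U x = U := if_neg hx

theorem oneDefectCoin_zero {U₀ U : Matrix (Fin 2) (Fin 2) ℂ} : oneDefectCoin U₀ U 0 = U₀ :=
  if_pos rfl

theorem walkStep_oneDefect_natCast (F : WalkState) (n : ℕ) :
    walkStep (oneDefectCoin !![a₀, b₀; c₀, d₀] !![a, b; c, d]) F n 0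
      = a * F ((n + 1 : ℕ) : ℤ) 0 + b * F ((n : ℤ) + 1) 1 := by
  rw [walkStep_apply_zero, oneDefectCoin_of_ne (by omega)]
  simp

theorem walkStep_oneDefect_add_two (F : WalkState) (n : ℕ) :
    walkStep (oneDefectCoin !![a₀, b₀; c₀, d₀] !![a, b; c, d]) F (((n + 1 : ℕ) : ℤ) + 1) 1
      = c * F ((n + 1 : ℕ) : ℤ) 0 + d * F ((n : ℤ) + 1) 1 := by
  rw [walkStep_apply_one, add_sub_cancel_right, oneDefectCoin_of_ne (by omega)]
  simp

theorem walkStep_oneDefect_one (F : WalkState) :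
    walkStep (oneDefectCoin !![a₀, b₀; c₀, d₀] !![a, b; c, d]) F (((0 : ℕ) : ℤ) + 1) 1
      = c₀ * F 0 0 + d₀ * F 0 1 := by
  rw [walkStep_apply_one, add_sub_cancel_right, Nat.cast_zero, oneDefectCoin_zero]
  simp

theorem walkStep_oneDefect_neg_natCast (F : WalkState) (n : ℕ) :
    walkStep (oneDefectCoin !![a₀, b₀; c₀, d₀] !![a, b; c, d]) F (-(n : ℤ)) 1
      = c * F (-((n : ℤ) + 1)) 0 + d * F (-((n + 1 : ℕ) : ℤ)) 1 := by
  have e : -(n : ℤ) - 1 = -((n : ℤ) + 1) := by ring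
  rw [walkStep_apply_one, e, oneDefectCoin_of_ne (by omega)]
  simp

theorem walkStep_oneDefect_neg_add_two (F : WalkState) (n : ℕ) :
    walkStep (oneDefectCoin !![a₀, b₀; c₀, d₀] !![a, b; c, d]) F (-(((n + 1 : ℕ) : ℤ) + 1)) 0
      = a * F (-((n : ℤ) + 1)) 0 + b * F (-((n + 1 : ℕ) : ℤ)) 1 := by
  have e : -(((n + 1 : ℕ) : ℤ) + 1) + 1 = -((n : ℤ) + 1) := by push_cast; ring
  rw [walkStep_apply_zero, e, oneDefectCoin_of_ne (by omega)]
  simp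

theorem walkStep_oneDefect_neg_one (F : WalkState) :
    walkStep (oneDefectCoin !![a₀, b₀; c₀, d₀] !![a, b; c, d]) F (-(((0 : ℕ) : ℤ) + 1)) 0
      = a₀ * F 0 0 + b₀ * F 0 1 := by
  have e : -(((0 : ℕ) : ℤ) + 1) + 1 = 0 := by simp
  rw [walkStep_apply_zero, e, oneDefectCoin_zero]
  simp

/-- A geometric sequence solves a recurrence as soon as one instance holds, so six scalar equations
suffice: `h1`, `h2` on the right, `h3`, `h4` on the left, and `h5`, `h6` for the amplitudes that
leave the defect. -/
theorem walkStep_boundState {p q C C' r r' lam : ℂ} (h1 : lam * p = a * p * r + b * C)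
    (h2 : lam * C * r = c * p * r + d * C) (h3 : lam * q = d * q * r' + c * C')
    (h4 : lam * C' * r' = b * q * r' + a * C') (h5 : lam * C = c₀ * p + d₀ * q)
    (h6 : lam * C' = a₀ * p + b₀ * q) :
    walkStep (oneDefectCoin !![a₀, b₀; c₀, d₀] !![a, b; c, d]) (boundState p q C C' r r')
      = lam • boundState p q C C' r r' := by
  have hs : ∀ (F : WalkState) x i, (lam • F) x i = lam * F x i := fun _ _ _ => rfl
  refine walkState_ext (fun n => ?_) (fun n => ?_) (fun n => ?_) (fun n => ?_)
  · rw [walkStep_oneDefect_natCast, hs, boundState_natCast_zero, boundState_natCast_zero,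
      boundState_add_one_one, pow_succ']
    linear_combination (-r ^ n) * h1
  · cases n with
    | zero =>
      rw [walkStep_oneDefect_one, hs, boundState_add_one_one]
      simp only [boundState, pow_zero, mul_one]
      exact h5.symm
    | succ n =>
      rw [walkStep_oneDefect_add_two, hs, boundState_natCast_zero, boundState_add_one_one,
        boundState_add_one_one, pow_succ']
      linear_combination (-r ^ n) * h2
  · rw [walkStep_oneDefect_neg_natCast, hs, boundState_neg_one, boundState_neg_one,
      boundState_neg_add_one_zero, pow_succ']
    linear_combination (-r' ^ n) * h3
  · cases n with
    | zero =>
      rw [walkStep_oneDefect_neg_one, hs, boundState_neg_add_one_zero]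
      simp only [boundState, pow_zero, mul_one]
      exact h6.symm
    | succ n =>
      rw [walkStep_oneDefect_neg_add_two, hs, boundState_neg_one, boundState_neg_add_one_zero,
        boundState_neg_add_one_zero, pow_succ']
      linear_combination (-r' ^ n) * h4

theorem tendsto_component_of_summable {F : WalkState} (hF : Summable (walkDensity F)) (i : Fin 2) :
    Filter.Tendsto (fun x => F x i) Filter.cofinite (nhds 0) := by
  have h := hF.tendsto_cofinite_zero
  have h1 : Filter.Tendsto (fun x => ‖F x i‖ ^ 2) Filter.cofinite (nhds 0) := by
    refine squeeze_zero (fun x => sq_nonneg _) (fun x => ?_) h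
    fin_cases i <;> simp [walkDensity]
  rw [tendsto_zero_iff_norm_tendsto_zero]
  have h2 := h1.sqrt
  simpa [Real.sqrt_sq] using h2

/-- A square summable eigenvector is geometric on both half lines. -/
theorem exists_eq_boundState {G : WalkState} {lam : ℂ} (ha : a ≠ 0)
    (hU : !![a, b; c, d] ∈ Matrix.unitaryGroup (Fin 2) ℂ) (hlam : ‖lam‖ = 1)
    (hG : Summable (walkDensity G))
    (he : walkStep (oneDefectCoin !![a₀, b₀; c₀, d₀] !![a, b; c, d]) G = lam • G) :
    ∃ p q C C' r r' : ℂ, G = boundState p q C C' r r' ∧ ‖r‖ < 1 ∧ ‖r'‖ < 1 ∧ ‖p‖ = ‖C‖ ∧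
      ‖q‖ = ‖C'‖ ∧ lam * p = a * p * r + b * C ∧ lam * C * r = c * p * r + d * C ∧
      lam * q = d * q * r' + c * C' ∧ lam * C' * r' = b * q * r' + a * C' ∧
      lam * C = c₀ * p + d₀ * q ∧ lam * C' = a₀ * p + b₀ * q := by
  have hd : ‖d‖ = ‖a‖ := (UnitaryEntries.of_mem hU).norm_d
  have hd0 : d ≠ 0 := by rw [← norm_ne_zero_iff, hd]; exact norm_ne_zero_iff.2 ha
  have hiso := norm_sq_add_norm_sq_of_unitary hU
  have hs : ∀ x i, walkStep (oneDefectCoin !![a₀, b₀; c₀, d₀] !![a, b; c, d]) G x i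
      = lam * G x i := fun x i => by rw [he]; rfl
  have hi1 : Function.Injective fun n : ℕ => (n : ℤ) := Nat.cast_injective
  have hi2 : Function.Injective fun n : ℕ => (n : ℤ) + 1 := fun m n h => by simpa using h
  have hi3 : Function.Injective fun n : ℕ => -(n : ℤ) := fun m n h => by simpa using h
  have hi4 : Function.Injective fun n : ℕ => -((n : ℤ) + 1) := fun m n h => by
    simp only [neg_inj, add_left_inj, Nat.cast_inj] at h; exact h
  have ht : ∀ (i : Fin 2) {k : ℕ → ℤ}, Function.Injective k →
      Filter.Tendsto (fun n => G (k n) i) Filter.atTop (nhds 0) := fun i k hk => by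
    rw [← Nat.cofinite_eq_atTop]
    exact (tendsto_component_of_summable hG i).comp hk.tendsto_cofinite
  obtain ⟨hR, r, hr, hgeo⟩ := exists_geometric_of_tendsto_zero (b := b) (c := c) ha hd hiso hlam
    (X := fun n => G n 0) (Y := fun n => G ((n : ℤ) + 1) 1)
    (fun n => by rw [← hs, walkStep_oneDefect_natCast])
    (fun n => by rw [← hs, walkStep_oneDefect_add_two]) (ht 0 hi1) (ht 1 hi2)
  -- Reflection swaps the chiralities, so the left half line obeys the same recurrence with a, d and
  -- b, c interchanged.
  obtain ⟨hL, r', hr', hgeo'⟩ := exists_geometric_of_tendsto_zero (a := d) (b := c) (c := b)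
    (d := a) hd0 hd.symm
    (fun u v => by rw [add_comm (‖u‖ ^ 2), ← hiso v u, add_comm (d * u), add_comm (b * u)]; ring)
    hlam (X := fun n => G (-(n : ℤ)) 1) (Y := fun n => G (-((n : ℤ) + 1)) 0)
    (fun n => by rw [← hs, walkStep_oneDefect_neg_natCast]; ring)
    (fun n => by rw [← hs, walkStep_oneDefect_neg_add_two]; ring) (ht 1 hi3) (ht 0 hi4)
  simp only [Nat.cast_zero, zero_add, neg_zero] at hR hgeo hL hgeo'
  refine ⟨G 0 0, G 0 1, G 1 1, G (-1) 0, r, r', ?_, hr, hr', hR, hL, ?_, ?_, ?_, ?_, ?_, ?_⟩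
  · refine walkState_ext (fun n => ?_) (fun n => ?_) (fun n => ?_) (fun n => ?_)
    · rw [boundState_natCast_zero]; exact (hgeo n).1
    · rw [boundState_add_one_one]; exact (hgeo n).2
    · rw [boundState_neg_one]; exact (hgeo' n).1
    · rw [boundState_neg_add_one_zero]; exact (hgeo' n).2
  · have h := walkStep_oneDefect_natCast (a₀ := a₀) (b₀ := b₀) (c₀ := c₀) (d₀ := d₀) (a := a)
      (b := b) (c := c) (d := d) G 0
    rw [hs, (hgeo (0 + 1)).1, (hgeo 0).2] at h
    simpa [mul_assoc] using h
  · have h := walkStep_oneDefect_add_two (a₀ := a₀) (b₀ := b₀) (c₀ := c₀) (d₀ := d₀) (a := a)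
      (b := b) (c := c) (d := d) G 0
    rw [hs, (hgeo (0 + 1)).1, (hgeo 0).2, (hgeo (0 + 1)).2] at h
    simpa [mul_assoc] using h
  · have h := walkStep_oneDefect_neg_natCast (a₀ := a₀) (b₀ := b₀) (c₀ := c₀) (d₀ := d₀) (a := a)
      (b := b) (c := c) (d := d) G 0
    rw [hs, (hgeo' (0 + 1)).1, (hgeo' 0).2] at h
    simpa [mul_assoc, add_comm] using h
  · have h := walkStep_oneDefect_neg_add_two (a₀ := a₀) (b₀ := b₀) (c₀ := c₀) (d₀ := d₀) (a := a)
      (b := b) (c := c) (d := d) G 0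
    rw [hs, (hgeo' (0 + 1)).1, (hgeo' 0).2, (hgeo' (0 + 1)).2] at h
    simpa [mul_assoc, add_comm] using h
  · rw [← walkStep_oneDefect_one (a := a) (b := b) (c := c) (d := d) (a₀ := a₀) (b₀ := b₀), hs]
    simp
  · rw [← walkStep_oneDefect_neg_one (a := a) (b := b) (c := c) (d := d) (c₀ := c₀) (d₀ := d₀), hs]
    simp

end Eigenvectors

/-! ### The quadratic equation from the junction at the defect -/

section EigenvalueEquation

variable {a b c d a₀ b₀ c₀ d₀ δ : ℂ} {m : ℝ}

/-- Replacing the constant term 1 by |c|² h h̄ and dividing by h gives |c|² Re h = m. Expanding |1 -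
h|² then finishes. -/
theorem normSq_one_sub_of_root {h : ℂ} (hc : c ≠ 0)
    (hh : ((‖c‖ ^ 2 : ℝ) : ℂ) * h ^ 2 - 2 * m * h + 1 = 0) (hn : ‖c‖ ^ 2 * ‖h‖ ^ 2 = 1) :
    ‖c‖ ^ 2 * ‖1 - h‖ ^ 2 = 1 - 2 * m + ‖c‖ ^ 2 := by
  have hc' : 0 < ‖c‖ ^ 2 := by positivity
  set k := ‖c‖ ^ 2 with hk
  have h0 : h ≠ 0 := by
    rintro rfl
    simp at hn
  have hn' : k * (h.re ^ 2 + h.im ^ 2) = 1 := by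
    rw [← hn, ← Complex.normSq_eq_norm_sq, Complex.normSq_apply]; ring
  have hnc : (k : ℂ) * (h * conj h) = 1 := by
    rw [Complex.mul_conj, Complex.normSq_eq_norm_sq]
    exact_mod_cast hn
  have hre : k * h.re = m := by
    have e : h * ((k : ℂ) * (h + conj h) - 2 * m) = 0 := by
      linear_combination hh + hnc
    have e2 := (mul_eq_zero.1 e).resolve_left h0
    have e3 := congrArg Complex.re e2
    simp at e3
    linarith
  rw [← Complex.normSq_eq_norm_sq, Complex.normSq_apply]
  simp only [Complex.sub_re, Complex.one_re, Complex.sub_im, Complex.one_im]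
  nlinarith

/-- The equations for h and λ combine to (λ² - bch)(1 - h) = -δ|a|²h, hence |r| |1 - h| = |a| |h|.
The decay rate is thus the same for both roots and both signs of λ. -/
theorem norm_sq_ratio_of_root {h lam r : ℂ} (hU : UnitaryEntries a b c d δ) (hc : c ≠ 0)
    (ha : a ≠ 0)
    (hh : ((‖c‖ ^ 2 : ℝ) : ℂ) * h ^ 2 - 2 * m * h + 1 = 0) (hn : ‖c‖ ^ 2 * ‖h‖ ^ 2 = 1)
    (hl : lam ^ 2 * (1 - h) = δ * (2 * m * h - 1 - h)) (hlam : ‖lam‖ = 1)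
    (hr : ‖a * lam * r‖ = ‖lam ^ 2 - b * c * h‖) :
    ‖r‖ ^ 2 = ‖a‖ ^ 2 / (1 - 2 * m + ‖c‖ ^ 2) := by
  have hk := normSq_one_sub_of_root hc hh hn
  have hac := hU.norm_sq_add
  have hc' : 0 < ‖c‖ ^ 2 := by positivity
  have ha' : 0 < ‖a‖ ^ 2 := by positivity
  have hne : 0 < ‖1 - h‖ ^ 2 := by
    have : (1 - h) ≠ 0 := by
      intro h1
      have h2 : h = 1 := by linear_combination -h1
      rw [h2, norm_one, one_pow, mul_one] at hn
      linarith
    positivity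
  have hcc : c * conj c = ((‖c‖ ^ 2 : ℝ) : ℂ) := by rw [Complex.mul_conj']; norm_cast
  have haa : a * conj a = ((‖a‖ ^ 2 : ℝ) : ℂ) := by rw [Complex.mul_conj']; norm_cast
  have e : (lam ^ 2 - b * c * h) * (1 - h) = -(δ * (a * conj a) * h) := by
    rw [hU.b_eq]
    rw [← hcc] at hh
    linear_combination hl + δ * h * hU.mul_conj_add - δ * hh
  have e2 := congrArg norm e
  rw [norm_mul, ← hr, norm_neg, norm_mul, norm_mul, norm_mul, norm_mul, hlam, hU.norm_det, haa,
    Complex.norm_real, Real.norm_of_nonneg ha'.le, mul_one, one_mul] at e2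
  have e3 : ‖r‖ * ‖1 - h‖ = ‖a‖ * ‖h‖ := by
    have : 0 < ‖a‖ := by positivity
    apply mul_left_cancel₀ this.ne'
    linarith
  have e4 : ‖r‖ ^ 2 * ‖1 - h‖ ^ 2 = ‖a‖ ^ 2 * ‖h‖ ^ 2 := by rw [← mul_pow, e3, mul_pow]
  rw [← hk, eq_div_iff (by positivity)]
  linear_combination ‖c‖ ^ 2 * e4 + ‖a‖ ^ 2 * hn

/-- The data of a bound state are determined by a root of a real quadratic equation. -/
theorem exists_root_of_boundState {p q C C' r r' lam : ℂ} (hU : UnitaryEntries a b c d δ)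
    (hU₀ : UnitaryEntries a₀ b₀ c₀ d₀ δ) (ha : a ≠ 0) (hc : c ≠ 0) (ha₀ : a₀ ≠ 0)
    (hm : m = (conj c * c₀).re) (hlam : ‖lam‖ = 1) (hr : ‖r‖ < 1) (hr' : ‖r'‖ < 1)
    (hpC : ‖p‖ = ‖C‖) (hqC : ‖q‖ = ‖C'‖) (hne : p ≠ 0 ∨ q ≠ 0)
    (h1 : lam * p = a * p * r + b * C)
    (h2 : lam * C * r = c * p * r + d * C) (h3 : lam * q = d * q * r' + c * C')
    (h4 : lam * C' * r' = b * q * r' + a * C') (h5 : lam * C = c₀ * p + d₀ * q)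
    (h6 : lam * C' = a₀ * p + b₀ * q) :
    ∃ h : ℂ, ((‖c‖ ^ 2 : ℝ) : ℂ) * h ^ 2 - 2 * m * h + 1 = 0 ∧ ‖c‖ ^ 2 * ‖h‖ ^ 2 = 1 ∧
      lam ^ 2 * (1 - h) = δ * (2 * m * h - 1 - h) ∧ lam * C = c * h * p ∧ lam * C' = b * h * q ∧
      d₀ * q = (c * h - c₀) * p ∧ a * lam * r = lam ^ 2 - b * c * h ∧
      d * lam * r' = lam ^ 2 - b * c * h := by
  have hl0 : lam ≠ 0 := by rintro rfl; simp at hlam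
  have hδ : δ ≠ 0 := by rintro rfl; simpa using hU.norm_det
  have hd₀ : d₀ ≠ 0 := by
    rw [← norm_ne_zero_iff, hU₀.norm_d]; exact norm_ne_zero_iff.2 ha₀
  have hd : d ≠ 0 := by
    rw [← norm_ne_zero_iff, hU.norm_d]; exact norm_ne_zero_iff.2 ha
  have hb : b ≠ 0 := by
    rw [← norm_ne_zero_iff, hU.norm_b]; exact norm_ne_zero_iff.2 hc
  have hp : p ≠ 0 := by
    intro hp
    rw [hp, norm_zero] at hpC
    rw [hp, norm_eq_zero.1 hpC.symm, mul_zero, mul_zero, zero_add] at h5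
    exact hne.elim (fun h => h hp) fun h => (mul_ne_zero hd₀ h) h5.symm
  have hq : q ≠ 0 := by
    intro hq
    rw [hq, norm_zero] at hqC
    rw [hq, norm_eq_zero.1 hqC.symm, mul_zero, mul_zero, add_zero] at h6
    exact (mul_ne_zero ha₀ hp) h6.symm
  -- The unknowns are the amplitudes next to the defect, normalized by those at the origin.
  -- Eliminating r or r' gives the same quadratic, with coefficients depending on λ, for h and for
  -- g.
  obtain ⟨h, hh⟩ : ∃ h, h = lam * C / (c * p) := ⟨_, rfl⟩
  obtain ⟨g, hg⟩ : ∃ g, g = lam * C' / (b * q) := ⟨_, rfl⟩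
  have hC : lam * C = c * h * p := by rw [hh]; field_simp
  have hC' : lam * C' = b * g * q := by rw [hg]; field_simp
  have hr1 : a * lam * r = lam ^ 2 - b * c * h := by
    apply mul_right_cancel₀ hp
    linear_combination (-lam) * h1 - b * hC
  have hr2 : d * lam * r' = lam ^ 2 - b * c * g := by
    apply mul_right_cancel₀ hq
    linear_combination (-lam) * h3 - c * hC'
  have hdet := hU.det_eq
  have hquad : b * c * h ^ 2 + (δ - lam ^ 2) * h + lam ^ 2 = 0 := by
    have e : lam * r * (h - 1) = d * h := by
      apply mul_left_cancel₀ (mul_ne_zero hc hp)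
      linear_combination lam * h2 + (-lam * r + d) * hC
    linear_combination (-a) * e + (h - 1) * hr1 - h * hdet
  have hquad' : b * c * g ^ 2 + (δ - lam ^ 2) * g + lam ^ 2 = 0 := by
    have e : lam * r' * (g - 1) = a * g := by
      apply mul_left_cancel₀ (mul_ne_zero hb hq)
      linear_combination lam * h4 + (-lam * r' + a) * hC'
    linear_combination (-d) * e + (g - 1) * hr2 - g * hdet
  -- If h and g were the two distinct roots, Vieta's formulas would give r r' = 1, which contradicts
  -- decay on both sides.
  have hgh : g = h := by
    by_contra hne'
    have hsum : b * c * (h + g) + (δ - lam ^ 2) = 0 := by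
      apply mul_left_cancel₀ (sub_ne_zero.2 hne')
      linear_combination hquad' - hquad
    have hprod : b * c * (h * g) = lam ^ 2 := by
      linear_combination h * hsum - hquad
    have hrr : r * r' = 1 := by
      have hx : a * d * lam ^ 2 ≠ 0 := mul_ne_zero (mul_ne_zero ha hd) (pow_ne_zero 2 hl0)
      apply mul_left_cancel₀ hx
      linear_combination (d * lam * r') * hr1 + (lam ^ 2 - b * c * h) * hr2 - lam ^ 2 * hsum
        + b * c * hprod - lam ^ 2 * hdet
    have := congrArg norm hrr
    rw [norm_mul, norm_one] at this
    nlinarith [norm_nonneg r, norm_nonneg r']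
  subst hgh
  have hn : ‖c‖ ^ 2 * ‖g‖ ^ 2 = 1 := by
    have e := congrArg norm hC
    rw [norm_mul, norm_mul, norm_mul, hlam, one_mul, ← hpC] at e
    have e' : ‖c‖ * ‖g‖ = 1 := by
      apply mul_right_cancel₀ (norm_ne_zero_iff.2 hp)
      linarith
    rw [← mul_pow, e', one_pow]
  have hcc : c * conj c = ((‖c‖ ^ 2 : ℝ) : ℂ) := by rw [Complex.mul_conj']; norm_cast
  have hmm : conj c * c₀ + c * conj c₀ = 2 * m := by
    have := Complex.add_conj (conj c * c₀)
    rw [map_mul, Complex.conj_conj, ← hm] at this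
    rw [this]; push_cast; ring
  have hjunction : d₀ * q = (c * g - c₀) * p := by
    linear_combination hC - h5
  have hroot : ((‖c‖ ^ 2 : ℝ) : ℂ) * g ^ 2 - 2 * m * g + 1 = 0 := by
    have e1 : (b * g - b₀) * q = a₀ * p := by linear_combination h6 - hC'
    -- Solvability of the two junction equations with p, q nonzero. Since the determinants agree, δ
    -- cancels and λ disappears, leaving the real quadratic.
    have e2 : (c * g - c₀) * (b * g - b₀) = a₀ * d₀ := by
      apply mul_right_cancel₀ (mul_ne_zero hp hq)
      linear_combination (c * g - c₀) * p * e1 - a₀ * p * hjunction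
    rw [hU.b_eq, hU₀.b_eq, hU₀.d_eq] at e2
    rw [← hcc, ← hmm]
    apply mul_left_cancel₀ hδ
    linear_combination (-1) * e2 - δ * hU₀.mul_conj_add
  refine ⟨g, hroot, hn, ?_, hC, hC', hjunction, hr1, hr2⟩
  rw [hU.b_eq] at hquad
  rw [← hcc] at hroot
  linear_combination hquad + δ * hroot

/-- The bound state that belongs to a root of the quadratic equation. -/
noncomputable def rootState (a b c d c₀ d₀ h lam : ℂ) : WalkState :=
  boundState d₀ (c * h - c₀) (c * h * d₀ / lam) (b * h * (c * h - c₀) / lam)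
    ((lam ^ 2 - b * c * h) / (a * lam)) ((lam ^ 2 - b * c * h) / (d * lam))

theorem walkStep_rootState {h lam : ℂ} (hU : UnitaryEntries a b c d δ)
    (hU₀ : UnitaryEntries a₀ b₀ c₀ d₀ δ) (ha : a ≠ 0) (hl0 : lam ≠ 0)
    (hm : m = (conj c * c₀).re)
    (hh : ((‖c‖ ^ 2 : ℝ) : ℂ) * h ^ 2 - 2 * m * h + 1 = 0)
    (hl : lam ^ 2 * (1 - h) = δ * (2 * m * h - 1 - h)) :
    walkStep (oneDefectCoin !![a₀, b₀; c₀, d₀] !![a, b; c, d]) (rootState a b c d c₀ d₀ h lam)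
      = lam • rootState a b c d c₀ d₀ h lam := by
  have hd : d ≠ 0 := by
    rw [← norm_ne_zero_iff, hU.norm_d]; exact norm_ne_zero_iff.2 ha
  have hcc : c * conj c = ((‖c‖ ^ 2 : ℝ) : ℂ) := by rw [Complex.mul_conj']; norm_cast
  have hmm : conj c * c₀ + c * conj c₀ = 2 * m := by
    have := Complex.add_conj (conj c * c₀)
    rw [map_mul, Complex.conj_conj, ← hm] at this
    rw [this]; push_cast; ring
  have hdet := hU.det_eq
  have hquad : b * c * h ^ 2 + (δ - lam ^ 2) * h + lam ^ 2 = 0 := by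
    rw [← hcc] at hh
    rw [hU.b_eq]
    linear_combination hl - δ * hh
  refine walkStep_boundState ?_ ?_ ?_ ?_ ?_ ?_
  · field_simp
    ring
  · field_simp
    linear_combination (c * d₀) * (-hquad - h * hdet)
  · field_simp
    ring
  · field_simp
    linear_combination (b * (c * h - c₀)) * (-hquad - h * hdet)
  · field_simp
    ring
  · field_simp
    rw [← hcc, ← hmm] at hh
    rw [hU.b_eq, hU₀.b_eq, hU₀.d_eq]
    linear_combination (-δ) * hh - δ * hU₀.mul_conj_add

end EigenvalueEquation

/-! ### The roots and the complete list of bound states -/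

section BoundStates

variable {a b c d a₀ b₀ c₀ d₀ δ : ℂ} {m : ℝ}

/-- The roots of `|c|² h² - 2 m h + 1`, for `s = 1` and `s = -1`. -/
noncomputable def quadRoot (c : ℂ) (m s : ℝ) : ℂ :=
  (m + s * Real.sqrt (‖c‖ ^ 2 - m ^ 2) * Complex.I) / ((‖c‖ ^ 2 : ℝ) : ℂ)

/-- |m| ≤ |c||c₀|, and |c₀| < 1 because a₀ ≠ 0. The quadratic therefore has negative discriminant.
-/
theorem sq_lt_of_unitary (hU₀ : UnitaryEntries a₀ b₀ c₀ d₀ δ) (hc : c ≠ 0) (ha₀ : a₀ ≠ 0)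
    (hm : m = (conj c * c₀).re) : m ^ 2 < ‖c‖ ^ 2 := by
  have h1 : |m| ≤ ‖c‖ * ‖c₀‖ := by
    rw [hm]
    refine (Complex.abs_re_le_norm _).trans ?_
    rw [norm_mul, RCLike.norm_conj]
  have h2 : m ^ 2 ≤ (‖c‖ * ‖c₀‖) ^ 2 := by
    rw [← sq_abs]
    exact pow_le_pow_left₀ (abs_nonneg _) h1 2
  have h3 := hU₀.norm_sq_add
  have h4 : 0 < ‖a₀‖ ^ 2 := by positivity
  have h5 : 0 < ‖c‖ ^ 2 := by positivity
  nlinarith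

theorem ofReal_sqrt_mul_self {x : ℝ} (hx : 0 ≤ x) :
    ((Real.sqrt x : ℝ) : ℂ) * (Real.sqrt x : ℝ) = x := by
  rw [← Complex.ofReal_mul, Real.mul_self_sqrt hx]

theorem quadRoot_root (hc : c ≠ 0) (hmc : m ^ 2 < ‖c‖ ^ 2) {s : ℝ} (hs : s ^ 2 = 1) :
    ((‖c‖ ^ 2 : ℝ) : ℂ) * quadRoot c m s ^ 2 - 2 * m * quadRoot c m s + 1 = 0 := by
  have h0 : ((‖c‖ ^ 2 : ℝ) : ℂ) ≠ 0 := by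
    have : ‖c‖ ^ 2 ≠ 0 := by positivity
    exact_mod_cast this
  have h1 := ofReal_sqrt_mul_self (sub_nonneg.2 hmc.le)
  have hs' : (s : ℂ) ^ 2 = 1 := by exact_mod_cast hs
  rw [Complex.ofReal_sub] at h1
  rw [quadRoot]
  set n : ℂ := ((Real.sqrt (‖c‖ ^ 2 - m ^ 2) : ℝ) : ℂ)
  set k : ℂ := ((‖c‖ ^ 2 : ℝ) : ℂ)
  push_cast at h1
  field_simp
  linear_combination (s ^ 2 * n ^ 2) * Complex.I_sq - h1 - n ^ 2 * hs'

theorem eq_quadRoot_of_root (hc : c ≠ 0) (hmc : m ^ 2 < ‖c‖ ^ 2) {h : ℂ}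
    (hh : ((‖c‖ ^ 2 : ℝ) : ℂ) * h ^ 2 - 2 * m * h + 1 = 0) :
    h = quadRoot c m 1 ∨ h = quadRoot c m (-1) := by
  have h0 : ((‖c‖ ^ 2 : ℝ) : ℂ) ≠ 0 := by
    have : ‖c‖ ^ 2 ≠ 0 := by positivity
    exact_mod_cast this
  have h1 := ofReal_sqrt_mul_self (sub_nonneg.2 hmc.le)
  rw [Complex.ofReal_sub] at h1
  rw [quadRoot, quadRoot, eq_div_iff h0, eq_div_iff h0]
  set n : ℂ := ((Real.sqrt (‖c‖ ^ 2 - m ^ 2) : ℝ) : ℂ)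
  set k : ℂ := ((‖c‖ ^ 2 : ℝ) : ℂ)
  push_cast at h1 ⊢
  have e : (h * k - m - n * Complex.I) * (h * k - m + n * Complex.I) = 0 := by
    linear_combination k * hh + h1 - n ^ 2 * Complex.I_sq
  rcases mul_eq_zero.1 e with e | e
  · left; linear_combination e
  · right; linear_combination e

theorem norm_quadRoot (hc : c ≠ 0) (hmc : m ^ 2 < ‖c‖ ^ 2) {s : ℝ} (hs : s ^ 2 = 1) :
    ‖c‖ ^ 2 * ‖quadRoot c m s‖ ^ 2 = 1 := by
  have hk : 0 < ‖c‖ ^ 2 := by positivity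
  have h1 := Real.mul_self_sqrt (sub_nonneg.2 hmc.le)
  have e : ‖(m + s * Real.sqrt (‖c‖ ^ 2 - m ^ 2) * Complex.I : ℂ)‖ ^ 2 = ‖c‖ ^ 2 := by
    rw [← Complex.ofReal_mul, ← Complex.normSq_eq_norm_sq ((m : ℂ) + _), Complex.normSq_add_mul_I,
      mul_pow, hs, one_mul, pow_two (Real.sqrt _), h1]
    ring
  rw [quadRoot, norm_div, div_pow, Complex.norm_real, Real.norm_of_nonneg hk.le, e]
  field_simp

theorem quadRoot_ne (hc : c ≠ 0) (hmc : m ^ 2 < ‖c‖ ^ 2) : quadRoot c m 1 ≠ quadRoot c m (-1) := by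
  have h0 : ((‖c‖ ^ 2 : ℝ) : ℂ) ≠ 0 := by
    have : ‖c‖ ^ 2 ≠ 0 := by positivity
    exact_mod_cast this
  intro h
  rw [quadRoot, quadRoot, div_left_inj' h0] at h
  have h1 := congrArg Complex.im h
  simp at h1
  have h2 := Real.sqrt_pos.2 (sub_pos.2 hmc)
  linarith

/-- By the quadratic and |c|² h h̄ = 1, (2mh - 1 - h) h̄ = h (1 - h̄), so both sides of the equation
for λ² carry factors of equal modulus. -/
theorem norm_eq_one_of_root {h lam : ℂ} (hδ : ‖δ‖ = 1) (h1 : h ≠ 1)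
    (hh : ((‖c‖ ^ 2 : ℝ) : ℂ) * h ^ 2 - 2 * m * h + 1 = 0) (hn : ‖c‖ ^ 2 * ‖h‖ ^ 2 = 1)
    (hl : lam ^ 2 * (1 - h) = δ * (2 * m * h - 1 - h)) : ‖lam‖ = 1 := by
  have h0 : h ≠ 0 := by
    rintro rfl
    simp at hn
  have hnc : ((‖c‖ ^ 2 : ℝ) : ℂ) * (h * conj h) = 1 := by
    rw [Complex.mul_conj, Complex.normSq_eq_norm_sq]
    exact_mod_cast hn
  have e : (2 * m * h - 1 - h) * conj h = h * conj (1 - h) := by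
    rw [map_sub, map_one]
    linear_combination (-conj h) * hh + h * hnc
  have e1 : ‖2 * m * h - 1 - h‖ = ‖1 - h‖ := by
    have := congrArg norm e
    rw [norm_mul, norm_mul, RCLike.norm_conj, RCLike.norm_conj, mul_comm] at this
    exact mul_left_cancel₀ (norm_ne_zero_iff.2 h0) this
  have e2 := congrArg norm hl
  rw [norm_mul, norm_mul, hδ, one_mul, e1, norm_pow] at e2
  have h2 : ‖1 - h‖ ≠ 0 := norm_ne_zero_iff.2 (sub_ne_zero.2 (Ne.symm h1))
  have e3 : ‖lam‖ ^ 2 = 1 := mul_right_cancel₀ h2 (by rw [e2, one_mul])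
  nlinarith [norm_nonneg lam]

theorem ne_one_of_norm {h : ℂ} (hU : UnitaryEntries a b c d δ) (ha : a ≠ 0)
    (hn : ‖c‖ ^ 2 * ‖h‖ ^ 2 = 1) : h ≠ 1 := by
  rintro rfl
  rw [norm_one, one_pow, mul_one] at hn
  have h1 := hU.norm_sq_add
  have h2 : 0 < ‖a‖ ^ 2 := by positivity
  linarith

theorem denom_pos (hmc : m ^ 2 < ‖c‖ ^ 2) : 0 < 1 - 2 * m + ‖c‖ ^ 2 := by
  nlinarith [sq_nonneg (1 - m)]

/-- Denominator minus numerator is 2(|c|² - m). This is where the localization threshold arises. -/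
theorem ratio_lt_one_iff (hU : UnitaryEntries a b c d δ) (hmc : m ^ 2 < ‖c‖ ^ 2) :
    ‖a‖ ^ 2 / (1 - 2 * m + ‖c‖ ^ 2) < 1 ↔ m < ‖c‖ ^ 2 := by
  rw [div_lt_one (denom_pos hmc)]
  have := hU.norm_sq_add
  constructor <;> intro h <;> linarith

/-- Every square summable eigenvector is a multiple of the bound state of one of the roots. -/
theorem exists_eq_smul_rootState
    (hU : !![a, b; c, d] ∈ Matrix.unitaryGroup (Fin 2) ℂ)
    (hU₀ : !![a₀, b₀; c₀, d₀] ∈ Matrix.unitaryGroup (Fin 2) ℂ)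
    (hdet : (!![a, b; c, d]).det = (!![a₀, b₀; c₀, d₀]).det)
    (ha : a ≠ 0) (hc : c ≠ 0) (ha₀ : a₀ ≠ 0) (hm : m = (conj c * c₀).re)
    {G : WalkState} {lam : ℂ} (hG : Summable (walkDensity G)) (hG0 : G ≠ 0)
    (he : walkStep (oneDefectCoin !![a₀, b₀; c₀, d₀] !![a, b; c, d]) G = lam • G) :
    m < ‖c‖ ^ 2 ∧ ∃ h : ℂ, (h = quadRoot c m 1 ∨ h = quadRoot c m (-1)) ∧
      lam ^ 2 * (1 - h) = (!![a, b; c, d]).det * (2 * m * h - 1 - h) ∧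
      ∃ z : ℂ, G = z • rootState a b c d c₀ d₀ h lam := by
  have hE := UnitaryEntries.of_mem hU
  have hE₀ := UnitaryEntries.of_mem hU₀
  rw [← hdet] at hE₀
  have hmc := sq_lt_of_unitary hE₀ hc ha₀ hm
  have hcoin : ∀ x, oneDefectCoin !![a₀, b₀; c₀, d₀] !![a, b; c, d] x ∈
      Matrix.unitaryGroup (Fin 2) ℂ := by
    intro x
    unfold oneDefectCoin
    split_ifs
    exacts [hU₀, hU]
  have hlam : ‖lam‖ = 1 := by
    refine (walkIsometry _ hcoin).norm_eigenvalue (f := toWalkSpace G hG) ?_ ?_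
    · apply WalkSpace.state_injective
      rw [state_walkIsometry, WalkSpace.state_smul, WalkSpace.state_toWalkSpace, he]
    · intro h0
      exact hG0 (congrArg WalkSpace.state h0)
  have hl0 : lam ≠ 0 := by rintro rfl; simp at hlam
  have hd₀ : d₀ ≠ 0 := by
    rw [← norm_ne_zero_iff, hE₀.norm_d]; exact norm_ne_zero_iff.2 ha₀
  have hd : d ≠ 0 := by
    rw [← norm_ne_zero_iff, hE.norm_d]; exact norm_ne_zero_iff.2 ha
  obtain ⟨p, q, C, C', r, r', rfl, hr, hr', hpC, hqC, h1, h2, h3, h4, h5, h6⟩ :=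
    exists_eq_boundState ha hU hlam hG he
  have hne : p ≠ 0 ∨ q ≠ 0 := by
    by_contra! h
    obtain ⟨rfl, rfl⟩ := h
    rw [norm_zero] at hpC hqC
    rw [norm_eq_zero.1 hpC.symm, norm_eq_zero.1 hqC.symm] at hG0
    apply hG0
    have := smul_boundState 0 0 0 0 r r' 0
    simpa using this.symm
  obtain ⟨h, hroot, hn, hl, hC, hC', hj, hr1, hr2⟩ := exists_root_of_boundState hE hE₀ ha hc ha₀ hm
    hlam hr hr' hpC hqC hne h1 h2 h3 h4 h5 h6
  have hS := norm_sq_ratio_of_root hE hc ha hroot hn hl hlam (congrArg norm hr1)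
  -- `rootState` has left amplitude d₀ at the origin, which dictates the scalar p / d₀.
  refine ⟨?_, h, eq_quadRoot_of_root hc hmc hroot, hl, p / d₀, ?_⟩
  · rw [← ratio_lt_one_iff hE hmc, ← hS]
    nlinarith [norm_nonneg r]
  · rw [rootState, smul_boundState]
    congr 1
    · field_simp
    · field_simp; linear_combination hj
    · field_simp; linear_combination hC
    · field_simp
      linear_combination d₀ * hC' + b * h * hj
    · field_simp; linear_combination hr1
    · field_simp; linear_combination hr2

/-- The sign of a Boolean. -/
def boolSign (s : Bool) : ℝ := if s then 1 else -1

theorem boolSign_sq (s : Bool) : boolSign s ^ 2 = 1 := by cases s <;> simp [boolSign]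

/-- The time averaged limit of a walk with `m < |c|²`, as a sum over the bound states. -/
theorem tendsto_timeAverage_of_lt
    (hU : !![a, b; c, d] ∈ Matrix.unitaryGroup (Fin 2) ℂ)
    (hU₀ : !![a₀, b₀; c₀, d₀] ∈ Matrix.unitaryGroup (Fin 2) ℂ)
    (hdet : (!![a, b; c, d]).det = (!![a₀, b₀; c₀, d₀]).det)
    (ha : a ≠ 0) (hc : c ≠ 0) (ha₀ : a₀ ≠ 0) (hm : m = (conj c * c₀).re) (hlt : m < ‖c‖ ^ 2)
    (α β : ℂ) {S : ℝ} (hS : S = ‖a‖ ^ 2 / (1 - 2 * m + ‖c‖ ^ 2)) {q : Bool → ℂ}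
    (hq : ∀ s, q s = c * quadRoot c m (boolSign s) - c₀) :
    ∃ D : Bool → ℤ → ℝ, (∀ s, D s 0 = ‖d₀‖ ^ 2 + ‖q s‖ ^ 2) ∧
      (∀ s (n : ℕ), D s ((n : ℤ) + 1) = ‖d₀‖ ^ 2 * (1 + S) * S ^ n) ∧
      (∀ s (n : ℕ), D s (-((n : ℤ) + 1)) = ‖q s‖ ^ 2 * (1 + S) * S ^ n) ∧
      ∀ x, Filter.Tendsto (fun T : ℕ => timeAverage
        (oneDefectCoin !![a₀, b₀; c₀, d₀] !![a, b; c, d]) (originState α β) T x) Filter.atTop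
        (nhds (2 * ∑ s, ‖conj d₀ * α + conj (q s) * β‖ ^ 2 * D s x
          / (2 * (‖d₀‖ ^ 2 + ‖q s‖ ^ 2) / (1 - S)) ^ 2)) := by
  have hE := UnitaryEntries.of_mem hU
  have hE₀ := UnitaryEntries.of_mem hU₀
  rw [← hdet] at hE₀
  set δ := (!![a, b; c, d]).det
  have hmc := sq_lt_of_unitary hE₀ hc ha₀ hm
  have hcoin : ∀ x, oneDefectCoin !![a₀, b₀; c₀, d₀] !![a, b; c, d] x ∈
      Matrix.unitaryGroup (Fin 2) ℂ := by
    intro x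
    unfold oneDefectCoin
    split_ifs
    exacts [hU₀, hU]
  set h : Bool → ℂ := fun s => quadRoot c m (boolSign s) with hh
  have hroot := fun s => quadRoot_root (m := m) hc hmc (boolSign_sq s)
  have hn := fun s => norm_quadRoot (m := m) hc hmc (boolSign_sq s)
  have h1 : ∀ s, h s ≠ 1 := fun s => ne_one_of_norm hE ha (hn s)
  have hinj : Function.Injective h := by
    have := quadRoot_ne (m := m) hc hmc
    intro s t hst
    cases s <;> cases t <;> simp [hh, boolSign] at hst ⊢
    exacts [this hst.symm, this hst]
  have hL : ∀ s, ∃ z : ℂ, z ^ 2 = δ * (2 * m * h s - 1 - h s) / (1 - h s) := fun s =>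
    IsAlgClosed.exists_pow_nat_eq _ two_pos
  choose L hL using hL
  have hL' : ∀ s, L s ^ 2 * (1 - h s) = δ * (2 * m * h s - 1 - h s) := fun s => by
    rw [hL, div_mul_cancel₀ _ (sub_ne_zero.2 (h1 s).symm)]
  -- A bound state is indexed by a root and by the sign of the square root of λ².
  set lam : Bool × Bool → ℂ := fun i => (boolSign i.2 : ℂ) * L i.1 with hlamdef
  have hsq : ∀ s : Bool, (boolSign s : ℂ) ^ 2 = 1 := fun s => by exact_mod_cast boolSign_sq s
  have hlamL : ∀ i, lam i ^ 2 = L i.1 ^ 2 := fun i => by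
    rw [hlamdef, mul_pow, hsq, one_mul]
  have hlam2 : ∀ i, lam i ^ 2 * (1 - h i.1) = δ * (2 * m * h i.1 - 1 - h i.1) := fun i => by
    rw [hlamL, hL']
  have hlam1 : ∀ i, ‖lam i‖ = 1 := fun i =>
    norm_eq_one_of_root hE.norm_det (h1 i.1) (hroot i.1) (hn i.1) (hlam2 i)
  have hlam0 : ∀ i, lam i ≠ 0 := fun i h0 => by
    have := hlam1 i
    rw [h0, norm_zero] at this
    exact zero_ne_one this
  have hm1 : (m : ℂ) - 1 ≠ 0 := by
    have : m - 1 ≠ 0 := by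
      have h2 := hE.norm_sq_add
      have h3 : 0 < ‖a‖ ^ 2 := by positivity
      intro h4
      linarith
    exact_mod_cast this
  -- λ² is a Möbius function of h whose determinant is proportional to m - 1, so different roots
  -- have different λ². The sign separates the rest.
  have hlaminj : Function.Injective lam := by
    rintro ⟨s, σ⟩ ⟨t, τ⟩ hst
    have e : s = t := by
      apply hinj
      have e1 := hlam2 (s, σ)
      have e2 := hlam2 (t, τ)
      rw [hst] at e1
      have hδ : δ ≠ 0 := by
        intro h0
        have := hE.norm_det
        rw [h0, norm_zero] at this
        exact zero_ne_one this
      have e3 : (2 * δ * (m - 1)) * (h s - h t) = 0 := by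
        linear_combination (1 - h s) * e2 - (1 - h t) * e1
      exact sub_eq_zero.1 ((mul_eq_zero.1 e3).resolve_left
        (mul_ne_zero (mul_ne_zero two_ne_zero hδ) hm1))
    subst e
    have hLs : L s ≠ 0 := fun h0 => hlam0 (s, true) (by simp [hlamdef, h0])
    have e4 : (boolSign σ : ℂ) = boolSign τ := mul_right_cancel₀ hLs hst
    have e5 : boolSign σ = boolSign τ := by exact_mod_cast e4
    cases σ <;> cases τ <;> first | rfl | (exfalso; norm_num [boolSign] at e5)
  set F : Bool × Bool → WalkState := fun i => rootState a b c d c₀ d₀ (h i.1) (lam i) with hF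
  have hd₀ : d₀ ≠ 0 := by
    rw [← norm_ne_zero_iff, hE₀.norm_d]; exact norm_ne_zero_iff.2 ha₀
  have hch : ∀ s, ‖c‖ * ‖h s‖ = 1 := fun s => by
    have := hn s
    rw [← mul_pow] at this
    exact (pow_eq_one_iff_of_nonneg (by positivity) two_ne_zero).1 this
  have hr : ∀ i, ‖(lam i ^ 2 - b * c * h i.1) / (a * lam i)‖ ^ 2 = S := fun i => by
    rw [hS]
    refine norm_sq_ratio_of_root hE hc ha (hroot i.1) (hn i.1) (hlam2 i) (hlam1 i) ?_
    rw [mul_div_cancel₀ _ (mul_ne_zero ha (hlam0 i))]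
  have hr' : ∀ i, ‖(lam i ^ 2 - b * c * h i.1) / (d * lam i)‖ ^ 2 = S := fun i => by
    rw [← hr i, norm_div, norm_div, norm_mul d, norm_mul a, hE.norm_d]
  have hC : ∀ i, ‖c * h i.1 * d₀ / lam i‖ = ‖d₀‖ := fun i => by
    rw [norm_div, norm_mul, norm_mul, hch, hlam1, one_mul, div_one]
  have hC' : ∀ i, ‖b * h i.1 * (c * h i.1 - c₀) / lam i‖ = ‖c * h i.1 - c₀‖ := fun i => by
    rw [norm_div, norm_mul, norm_mul, hE.norm_b, hch, hlam1, one_mul, div_one]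
  have hS1 : S < 1 := by rw [hS]; exact (ratio_lt_one_iff hE hmc).2 hlt
  have hsum := fun i => hasSum_walkDensity_boundState (hC i) (hC' i) (hr i) (hr' i) hS1
  refine ⟨fun s => walkDensity (F (s, true)), fun s => ?_, fun s n => ?_, fun s n => ?_,
    fun x => ?_⟩
  · rw [hq]; rfl
  · exact walkDensity_boundState_pos (hC _) (hr _) n
  · rw [hq]; exact walkDensity_boundState_neg (hC' _) (hr' _) n
  · have hindep : ∀ i, walkDensity (F i) x = walkDensity (F (i.1, true)) x := by
      intro i
      match x with
      | .ofNat 0 => rfl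
      | .ofNat (n + 1) =>
        exact (walkDensity_boundState_pos (hC i) (hr i) n).trans
          (walkDensity_boundState_pos (hC (i.1, true)) (hr (i.1, true)) n).symm
      | .negSucc n =>
        have e : Int.negSucc n = -((n : ℤ) + 1) := Int.negSucc_eq n
        rw [e]
        exact (walkDensity_boundState_neg (hC' i) (hr' i) n).trans
          (walkDensity_boundState_neg (hC' (i.1, true)) (hr' (i.1, true)) n).symm
    have ht := tendsto_timeAverage hcoin F lam _ hsum ?_ ?_ hlaminj ?_ α β x
    · convert ht using 2
      rw [Fintype.sum_prod_type, Finset.mul_sum]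
      refine Finset.sum_congr rfl fun s _ => ?_
      rw [Fintype.sum_bool, hindep (s, true), hindep (s, false), hq s]
      change _ = ‖conj d₀ * α + conj (c * h s - c₀) * β‖ ^ 2 * walkDensity (F (s, true)) x
        / (2 * (‖d₀‖ ^ 2 + ‖c * h s - c₀‖ ^ 2) / (1 - S)) ^ 2 +
        ‖conj d₀ * α + conj (c * h s - c₀) * β‖ ^ 2 * walkDensity (F (s, true)) x
        / (2 * (‖d₀‖ ^ 2 + ‖c * h s - c₀‖ ^ 2) / (1 - S)) ^ 2
      ring
    · intro i
      have : 0 < ‖d₀‖ ^ 2 := by positivity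
      have : 0 < 1 - S := by linarith
      positivity
    · intro i
      exact walkStep_rootState hE hE₀ ha (hlam0 i) hm (hroot i.1) (hlam2 i)
    · intro G μ hG he hG0
      obtain ⟨-, g, hg, hl, z, hz⟩ :=
        exists_eq_smul_rootState hU hU₀ hdet ha hc ha₀ hm hG hG0 he
      obtain ⟨s, rfl⟩ : ∃ s, g = h s := by
        rcases hg with hg | hg
        · exact ⟨true, hg⟩
        · exact ⟨false, hg⟩
      have e : μ ^ 2 = L s ^ 2 :=
        mul_right_cancel₀ (sub_ne_zero.2 (h1 s).symm) (hl.trans (hL' s).symm)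
      rcases sq_eq_sq_iff_eq_or_eq_neg.1 e with e | e
      · have e' : μ = lam (s, true) := by rw [e]; simp [hlamdef, boolSign]
        exact ⟨(s, true), e', z, by rw [hz, e']⟩
      · have e' : μ = lam (s, false) := by rw [e]; simp [hlamdef, boolSign]
        exact ⟨(s, false), e', z, by rw [hz, e']⟩

end BoundStates

/-! ### Evaluation of the limit measure -/

section LimitMeasure

variable {a b c d a₀ b₀ c₀ d₀ δ : ℂ} {m : ℝ}

/-- The three weighted sums over the two bound states that occur in the limit measure. -/
theorem weighted_sums {n v k A a2 b2 ζ : ℝ} (hn : n ≠ 0) (hk : k ≠ 0) (hA : A = (n ^ 2 - v ^ 2) / k)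
    (hA0 : A ≠ 0) {W Q : Bool → ℝ} (hQ : ∀ s, Q s = (boolSign s * n - v) ^ 2 / k)
    (hW : ∀ s, W s = A * a2 + Q s * b2 + 2 * (boolSign s * n - v) * ζ) :
    ∑ s, W s / (A + Q s) = a2 + b2 ∧
    ∑ s, W s * A / (A + Q s) ^ 2
      = k / (2 * n ^ 2) * ((n ^ 2 + v ^ 2) / k * a2 + A * b2 + 2 * v * ζ) ∧
    ∑ s, W s * Q s / (A + Q s) ^ 2
      = k / (2 * n ^ 2) * ((n ^ 2 + v ^ 2) / k * b2 + A * a2 - 2 * v * ζ) := by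
  have h0 : (n - v) * (n + v) ≠ 0 := by
    intro h
    apply hA0
    rw [hA, show n ^ 2 - v ^ 2 = (n - v) * (n + v) by ring, h, zero_div]
  have h1 : n - v ≠ 0 := left_ne_zero_of_mul h0
  have h2 : n + v ≠ 0 := right_ne_zero_of_mul h0
  have hQt : Q true = (n - v) ^ 2 / k := by rw [hQ]; simp [boolSign]
  have hQf : Q false = (n + v) ^ 2 / k := by rw [hQ]; simp only [boolSign]; norm_num; ring
  -- Each W_s contains the same factor n ∓ v as A + Q_s. After cancellation only powers of n remain
  -- in the denominators.
  have hNt : A + Q true = 2 * n * (n - v) / k := by rw [hQt, hA]; ring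
  have hNf : A + Q false = 2 * n * (n + v) / k := by rw [hQf, hA]; ring
  have hWt : W true = (n - v) * ((n + v) / k * a2 + (n - v) / k * b2 + 2 * ζ) := by
    rw [hW, hQt, hA]; simp only [boolSign]; norm_num; ring
  have hWf : W false = (n + v) * ((n - v) / k * a2 + (n + v) / k * b2 - 2 * ζ) := by
    rw [hW, hQf, hA]; simp only [boolSign]; norm_num; ring
  simp only [Fintype.sum_bool, hNt, hNf]
  rw [hWt, hWf, hQt, hQf, hA]
  refine ⟨?_, ?_, ?_⟩
  · field_simp
    ring
  · field_simp
    ring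
  · field_simp
    ring

theorem norm_sq_overlap (z w q β : ℂ) :
    ‖conj z * w + conj q * β‖ ^ 2
      = ‖z‖ ^ 2 * ‖w‖ ^ 2 + ‖q‖ ^ 2 * ‖β‖ ^ 2 + 2 * (w * conj β * conj z * q).re := by
  simp only [← Complex.normSq_eq_norm_sq]
  rw [Complex.normSq_add]
  simp only [map_mul, Complex.normSq_conj, Complex.conj_conj]
  congr 3
  ring

/-- The time averaged limit measure of a walk with `m < |c|²`. -/
theorem exists_limit_of_lt
    (hU : !![a, b; c, d] ∈ Matrix.unitaryGroup (Fin 2) ℂ)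
    (hU₀ : !![a₀, b₀; c₀, d₀] ∈ Matrix.unitaryGroup (Fin 2) ℂ)
    (hdet : (!![a, b; c, d]).det = (!![a₀, b₀; c₀, d₀]).det)
    (ha : a ≠ 0) (hc : c ≠ 0) (ha₀ : a₀ ≠ 0) (hm : m = (conj c * c₀).re) (hlt : m < ‖c‖ ^ 2)
    {α β : ℂ} (hinit : ‖α‖ ^ 2 + ‖β‖ ^ 2 = 1) :
    ∃ μ : ℤ → ℝ,
      IsTimeAveragedLimit (oneDefectCoin !![a₀, b₀; c₀, d₀] !![a, b; c, d]) (originState α β) μ ∧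
      μ 0 = (1 / 2) * (2 * (‖c‖ ^ 2 - m) / (1 - 2 * m + ‖c‖ ^ 2)) ^ 2 ∧
      (∀ n : ℕ,
        μ ((n : ℤ) + 1) =
          μ 0 * (‖c‖ ^ 2 * (1 - m) / ((‖c‖ ^ 2 - m ^ 2) * (1 - 2 * m + ‖c‖ ^ 2))) *
          (‖a‖ ^ 2 / (1 - 2 * m + ‖c‖ ^ 2)) ^ n *
          ((1 + ‖c₀‖ ^ 2 - 2 * m ^ 2 / ‖c‖ ^ 2) * ‖α‖ ^ 2 + ‖a₀‖ ^ 2 * ‖β‖ ^ 2 +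
            2 * (α * conj β * conj d₀ * (c₀ - (m : ℂ) / conj c)).re)) ∧
      (∀ n : ℕ,
        μ (-((n : ℤ) + 1)) =
          μ 0 * (‖c‖ ^ 2 * (1 - m) / ((‖c‖ ^ 2 - m ^ 2) * (1 - 2 * m + ‖c‖ ^ 2))) *
          (‖a‖ ^ 2 / (1 - 2 * m + ‖c‖ ^ 2)) ^ n *
          ((1 + ‖c₀‖ ^ 2 - 2 * m ^ 2 / ‖c‖ ^ 2) * ‖β‖ ^ 2 + ‖a₀‖ ^ 2 * ‖α‖ ^ 2 -
            2 * (α * conj β * conj d₀ * (c₀ - (m : ℂ) / conj c)).re)) := by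
  have hE := UnitaryEntries.of_mem hU
  have hE₀ := UnitaryEntries.of_mem hU₀
  rw [← hdet] at hE₀
  have hmc := sq_lt_of_unitary hE₀ hc ha₀ hm
  have hac := hE.norm_sq_add
  have hac₀ := hE₀.norm_sq_add
  have hD := denom_pos hmc
  obtain ⟨D, hD0, hDp, hDn, hlim⟩ := tendsto_timeAverage_of_lt hU hU₀ hdet ha hc ha₀ hm hlt α β rfl
    (q := fun s => c * quadRoot c m (boolSign s) - c₀) fun s => rfl
  refine ⟨_, hlim, ?_⟩
  have hk : 0 < ‖c‖ ^ 2 := by positivity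
  have hcc' : conj c ≠ 0 := by simpa using hc
  set n := Real.sqrt (‖c‖ ^ 2 - m ^ 2)
  have hn2 : n ^ 2 = ‖c‖ ^ 2 - m ^ 2 := Real.sq_sqrt (sub_nonneg.2 hmc.le)
  have hn0 : n ≠ 0 := (Real.sqrt_pos.2 (sub_pos.2 hmc)).ne'
  set v := (conj c * c₀).im with hv
  have hmv : conj c * c₀ = m + v * Complex.I := by
    rw [hm, hv, Complex.re_add_im]
  have hmv2 : m ^ 2 + v ^ 2 = ‖c‖ ^ 2 * ‖c₀‖ ^ 2 := by
    have := congrArg Complex.normSq hmv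
    rw [Complex.normSq_add_mul_I, map_mul, Complex.normSq_conj, Complex.normSq_eq_norm_sq,
      Complex.normSq_eq_norm_sq] at this
    exact this.symm
  have hd2 : ‖d₀‖ ^ 2 = ‖a₀‖ ^ 2 := by rw [hE₀.norm_d]
  have hA : ‖a₀‖ ^ 2 = (n ^ 2 - v ^ 2) / ‖c‖ ^ 2 := by
    rw [eq_div_iff hk.ne', hn2]
    linear_combination ‖c‖ ^ 2 * hac₀ + hmv2
  have hA0 : ‖a₀‖ ^ 2 ≠ 0 := by positivity
  have hc2 : ((‖c‖ ^ 2 : ℝ) : ℂ) = c * conj c := by rw [Complex.mul_conj']; norm_cast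
  have hc₀ : c₀ = (m + v * Complex.I) / conj c := by
    rw [eq_div_iff hcc', ← hmv]; ring
  -- Both amplitudes q_s are real multiples of i / c̄, so the sums over the roots become real.
  have hq : ∀ s, c * quadRoot c m (boolSign s) - c₀
      = ((boolSign s * n - v : ℝ) : ℂ) * (Complex.I / conj c) := by
    intro s
    rw [quadRoot, hc2, hc₀]
    push_cast
    field_simp
    ring
  have hcm : c₀ - (m : ℂ) / conj c = (v : ℂ) * (Complex.I / conj c) := by
    rw [hc₀]
    field_simp
    ring
  set ζ := (α * conj β * conj d₀ * (Complex.I / conj c)).re with hζ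
  have hre : ∀ x : ℝ, (α * conj β * conj d₀ * ((x : ℂ) * (Complex.I / conj c))).re = x * ζ := by
    intro x
    rw [hζ, ← Complex.re_ofReal_mul]
    congr 1
    ring
  have hQ : ∀ s, ‖c * quadRoot c m (boolSign s) - c₀‖ ^ 2
      = (boolSign s * n - v) ^ 2 / ‖c‖ ^ 2 := by
    intro s
    rw [hq, norm_mul, norm_div, Complex.norm_I, RCLike.norm_conj, Complex.norm_real, mul_pow,
      Real.norm_eq_abs, sq_abs]
    ring
  have hW : ∀ s, ‖conj d₀ * α + conj (c * quadRoot c m (boolSign s) - c₀) * β‖ ^ 2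
      = ‖a₀‖ ^ 2 * ‖α‖ ^ 2 + ‖c * quadRoot c m (boolSign s) - c₀‖ ^ 2 * ‖β‖ ^ 2
        + 2 * (boolSign s * n - v) * ζ := by
    intro s
    rw [norm_sq_overlap, hd2, hq, hre]
    ring
  -- The vectors (d₀, q_s) at the origin are orthogonal in ℂ², as the product of one q_s with the
  -- conjugate of the other is -(n² - v²)/|c|² = -|a₀|². Hence `s0` is Parseval's identity, and the
  -- value at the origin does not depend on α and β.
  obtain ⟨s0, sA, sQ⟩ := weighted_sums hn0 hk.ne' hA hA0 hQ hW
  have hNpos : ∀ s, 0 < ‖a₀‖ ^ 2 + ‖c * quadRoot c m (boolSign s) - c₀‖ ^ 2 := fun s => by positivity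
  set S := ‖a‖ ^ 2 / (1 - 2 * m + ‖c‖ ^ 2) with hS
  have hS1 : 1 - S = 2 * (‖c‖ ^ 2 - m) / (1 - 2 * m + ‖c‖ ^ 2) := by
    rw [hS, eq_div_iff hD.ne', sub_mul, div_mul_cancel₀ _ hD.ne']
    linarith
  have hS2 : 1 + S = 2 * (1 - m) / (1 - 2 * m + ‖c‖ ^ 2) := by
    rw [hS, eq_div_iff hD.ne', add_mul, div_mul_cancel₀ _ hD.ne']
    linarith
  have hkey : ∀ W N X : ℝ, W * X / (2 * N / (1 - S)) ^ 2 = (1 - S) ^ 2 / 4 * (W * X / N ^ 2) := by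
    intro W N X
    rw [div_pow, div_div_eq_mul_div]
    ring
  have e0 : (2 * ∑ s, ‖conj d₀ * α + conj (c * quadRoot c m (boolSign s) - c₀) * β‖ ^ 2 * D s 0
      / (2 * (‖d₀‖ ^ 2 + ‖c * quadRoot c m (boolSign s) - c₀‖ ^ 2) / (1 - S)) ^ 2)
      = (1 - S) ^ 2 / 2 := by
    simp only [hkey, ← Finset.mul_sum, hD0, hd2]
    rw [Finset.sum_congr rfl fun s _ => ?_, s0, hinit]
    · ring
    · have := (hNpos s).ne'
      field_simp
  have hκ : 1 + ‖c₀‖ ^ 2 - 2 * m ^ 2 / ‖c‖ ^ 2 = (n ^ 2 + v ^ 2) / ‖c‖ ^ 2 := by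
    rw [hn2]
    field_simp
    linear_combination (-1) * hmv2
  simp only [hcm, hre, e0, hκ, ← hn2]
  refine ⟨by rw [hS1]; ring, fun j => ?_, fun j => ?_⟩
  · simp only [hkey, ← Finset.mul_sum, hDp, hd2]
    rw [Finset.sum_congr rfl fun s _ => (show _ = ((1 + S) * S ^ j) *
      (‖conj d₀ * α + conj (c * quadRoot c m (boolSign s) - c₀) * β‖ ^ 2 * ‖a₀‖ ^ 2
        / (‖a₀‖ ^ 2 + ‖c * quadRoot c m (boolSign s) - c₀‖ ^ 2) ^ 2) by ring), ← Finset.mul_sum, sA,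
      hS2]
    have := hk.ne'
    field_simp
    ring
  · simp only [hkey, ← Finset.mul_sum, hDn, hd2]
    rw [Finset.sum_congr rfl fun s _ => (show _ = ((1 + S) * S ^ j) *
      (‖conj d₀ * α + conj (c * quadRoot c m (boolSign s) - c₀) * β‖ ^ 2 *
        ‖c * quadRoot c m (boolSign s) - c₀‖ ^ 2
        / (‖a₀‖ ^ 2 + ‖c * quadRoot c m (boolSign s) - c₀‖ ^ 2) ^ 2) by ring), ← Finset.mul_sum, sQ,
      hS2]
    have := hk.ne'
    field_simp
    ring

/-- If `|c|² ≤ m`, the time averages tend to zero everywhere. -/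
theorem tendsto_timeAverage_zero_of_le
    (hU : !![a, b; c, d] ∈ Matrix.unitaryGroup (Fin 2) ℂ)
    (hU₀ : !![a₀, b₀; c₀, d₀] ∈ Matrix.unitaryGroup (Fin 2) ℂ)
    (hdet : (!![a, b; c, d]).det = (!![a₀, b₀; c₀, d₀]).det)
    (ha : a ≠ 0) (hc : c ≠ 0) (ha₀ : a₀ ≠ 0) (hm : m = (conj c * c₀).re) (hle : ‖c‖ ^ 2 ≤ m)
    (α β : ℂ) :
    IsTimeAveragedLimit (oneDefectCoin !![a₀, b₀; c₀, d₀] !![a, b; c, d]) (originState α β)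
      fun _ => 0 := by
  have hcoin : ∀ x, oneDefectCoin !![a₀, b₀; c₀, d₀] !![a, b; c, d] x ∈
      Matrix.unitaryGroup (Fin 2) ℂ := by
    intro x
    unfold oneDefectCoin
    split_ifs
    exacts [hU₀, hU]
  intro x
  -- A nonzero square summable eigenvector would force m < |c|². The family of eigenvectors is empty
  -- and so is the limiting sum.
  have h := tendsto_timeAverage (ι := Empty) hcoin Empty.elim Empty.elim Empty.elim (fun i => i.elim)
    (fun i => i.elim) (fun i => i.elim) (fun i => i.elim) (fun G μ hG he hG0 =>
      absurd (exists_eq_smul_rootState hU hU₀ hdet ha hc ha₀ hm hG hG0 he).1 hle.not_gt) α β x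
  simpa using h

end LimitMeasure

/-! ### The limit theorem and the localization criterion -/

theorem theorem3p2
    (a b c d a₀ b₀ c₀ d₀ α β : ℂ)
    (hU : !![a, b; c, d] ∈ Matrix.unitaryGroup (Fin 2) ℂ)
    (hU₀ : !![a₀, b₀; c₀, d₀] ∈ Matrix.unitaryGroup (Fin 2) ℂ)
    (hdet : (!![a, b; c, d]).det = (!![a₀, b₀; c₀, d₀]).det)
    (ha : a ≠ 0) (hc : c ≠ 0) (ha₀ : a₀ ≠ 0)
    (hinit : ‖α‖ ^ 2 + ‖β‖ ^ 2 = 1)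
    (m : ℝ) (hm : m = (conj c * c₀).re) :
    (∃ μ : ℤ → ℝ,
      IsTimeAveragedLimit (oneDefectCoin !![a₀, b₀; c₀, d₀] !![a, b; c, d]) (originState α β) μ ∧
      μ 0 = (if ‖c‖ ^ 2 > m then 1 else 0) *
        ((1 / 2) * (2 * (‖c‖ ^ 2 - m) / (1 - 2 * m + ‖c‖ ^ 2)) ^ 2) ∧
      (∀ x : ℤ, 1 ≤ x →
        μ x = μ 0 * (‖c‖ ^ 2 * (1 - m) / ((‖c‖ ^ 2 - m ^ 2) * (1 - 2 * m + ‖c‖ ^ 2))) *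
          (‖a‖ ^ 2 / (1 - 2 * m + ‖c‖ ^ 2)) ^ (x.natAbs - 1) *
          ((1 + ‖c₀‖ ^ 2 - 2 * m ^ 2 / ‖c‖ ^ 2) * ‖α‖ ^ 2 + ‖a₀‖ ^ 2 * ‖β‖ ^ 2 +
            2 * (α * conj β * conj d₀ * (c₀ - (m : ℂ) / conj c)).re)) ∧
      (∀ x : ℤ, x ≤ -1 →
        μ x = μ 0 * (‖c‖ ^ 2 * (1 - m) / ((‖c‖ ^ 2 - m ^ 2) * (1 - 2 * m + ‖c‖ ^ 2))) *
          (‖a‖ ^ 2 / (1 - 2 * m + ‖c‖ ^ 2)) ^ (x.natAbs - 1) *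
          ((1 + ‖c₀‖ ^ 2 - 2 * m ^ 2 / ‖c‖ ^ 2) * ‖β‖ ^ 2 + ‖a₀‖ ^ 2 * ‖α‖ ^ 2 -
            2 * (α * conj β * conj d₀ * (c₀ - (m : ℂ) / conj c)).re))) ∧
    (‖c‖ ^ 2 > m → 0 < ‖a‖ ^ 2 / (1 - 2 * m + ‖c‖ ^ 2) ∧ ‖a‖ ^ 2 / (1 - 2 * m + ‖c‖ ^ 2) < 1) ∧
    (LocalizesAt (oneDefectCoin !![a₀, b₀; c₀, d₀] !![a, b; c, d]) (originState α β) 0 ↔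
      ‖c‖ ^ 2 > m) ∧
    ((∃ x : ℤ,
        LocalizesAt (oneDefectCoin !![a₀, b₀; c₀, d₀] !![a, b; c, d]) (originState α β) x) ↔
      ‖c‖ ^ 2 > m) := by
  have hE := UnitaryEntries.of_mem hU
  have hE₀ := UnitaryEntries.of_mem hU₀
  have hmc := sq_lt_of_unitary hE₀ hc ha₀ hm
  have hD := denom_pos hmc
  have hnot : ¬ ‖c‖ ^ 2 > m → ∀ x, ¬ LocalizesAt
      (oneDefectCoin !![a₀, b₀; c₀, d₀] !![a, b; c, d]) (originState α β) x := by
    rintro h x ⟨l, hl, ht⟩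
    exact hl.ne' (tendsto_nhds_unique ht
      (tendsto_timeAverage_zero_of_le hU hU₀ hdet ha hc ha₀ hm (not_lt.1 h) α β x))
  have hloc : ‖c‖ ^ 2 > m → LocalizesAt
      (oneDefectCoin !![a₀, b₀; c₀, d₀] !![a, b; c, d]) (originState α β) 0 := by
    intro h
    obtain ⟨μ, hμ, h0, -⟩ := exists_limit_of_lt hU hU₀ hdet ha hc ha₀ hm h hinit
    refine ⟨μ 0, ?_, hμ 0⟩
    rw [h0]
    have : 0 < ‖c‖ ^ 2 - m := sub_pos.2 h
    positivity
  refine ⟨?_, fun h => ⟨by positivity, (ratio_lt_one_iff hE hmc).2 h⟩,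
    ⟨fun h => by_contra fun h' => hnot h' 0 h, hloc⟩,
    ⟨fun ⟨x, h⟩ => by_contra fun h' => hnot h' x h, fun h => ⟨0, hloc h⟩⟩⟩
  by_cases h : ‖c‖ ^ 2 > m
  · obtain ⟨μ, hμ, h0, hp, hn⟩ := exists_limit_of_lt hU hU₀ hdet ha hc ha₀ hm h hinit
    refine ⟨μ, hμ, by rw [if_pos h, one_mul, h0], fun x hx => ?_, fun x hx => ?_⟩
    · obtain ⟨j, rfl⟩ : ∃ j : ℕ, x = (j : ℤ) + 1 := ⟨(x - 1).toNat, by omega⟩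
      have e : ((j : ℤ) + 1).natAbs - 1 = j := by omega
      rw [e]
      exact hp j
    · obtain ⟨j, rfl⟩ : ∃ j : ℕ, x = -((j : ℤ) + 1) := ⟨(-x - 1).toNat, by omega⟩
      have e : (-((j : ℤ) + 1)).natAbs - 1 = j := by omega
      rw [e]
      exact hn j
  -- Every formula away from the origin carries the factor μ(0), so the zero measure satisfies all
  -- of them.
  · refine ⟨fun _ => 0,
      tendsto_timeAverage_zero_of_le hU hU₀ hdet ha hc ha₀ hm (not_lt.1 h) α β, ?_, ?_, ?_⟩
    · rw [if_neg h, zero_mul]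
    · intro x _
      ring
    · intro x _
      ring
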